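/- Let $A_1,\dots,A_k$ be invertible real $2\times2$ matrices with positive entries, $A_i=\begin{pmatrix}a_i&b_i\\c_i&d_i\end{pmatrix}$, and let $p=(p_1,\dots,p_k)$ be a probability vector. Let $D=\{z\in\mathbb C:|z-\tfrac12|<\tfrac12\}$ and let $H^2(D)$ be the Hardy–Hilbert space of functions $f$ that are holomorphic on $D$ and satisfy $\sup_{0\le r<1/2}\int_0^1|f(\tfrac12+re^{2\pi i\theta})|^2\,d\theta<\infty$. For $z\in D$ put $$w_{A_i}(z)=(a_i+c_i-b_i-d_i)z+b_i+d_i,\qquad \phi_{A_i}(z)=\frac{(a_i-b_i)z+b_i}{w_{A_i}(z)},$$ and for $t\in\mathbb C$ let $\mathcal L_t:H^2(D)\to H^2(D)$ be the operator $$(\mathcal L_tf)(z)=\sum_{i=1}^kp_i\,w_{A_i}(z)^t\,f(\phi_{A_i}(z)),\qquad w_{A_i}(z)^t=\exp(t\log w_{A_i}(z)),$$ where $\log$ is the principal branch of the logarithm on the right half plane (which contains $w_{A_i}(D)$). Let $\mu_p$ be the Bernoulli measure on $\{1,\dots,k\}^{\mathbb N}$ associated to $p$, and let $$\Lambda=\lim_{n\to\infty}\frac1n\int\log\|A_{i_1}\cdots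 A_{i_n}\|\,d\mu_p(i_1,i_2,\dots)$$ be the Lyapunov exponent, where $\|\cdot\|$ is the Euclidean operator norm. Then the limit $\Lambda$ exists in $\mathbb R$, and there is an open neighbourhood $U\subset\mathbb C$ of $0$ such that for every $t\in U$ the operator $\mathcal L_t$ has a top eigenvalue $\lambda_1(t)$, i.e. an algebraically simple eigenvalue whose modulus is strictly larger than that of every other eigenvalue; the function $\lambda_1$ is holomorphic on $U$; and $$\lambda_1'(0)=\Lambda .$$ -/

import Mathlib

open MeasureTheory Filter Topology

noncomputable section

/-- The open disc `D` of radius `1/2` centred at `1/2`. -/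
def discD : Set ℂ := Metric.ball (1 / 2) (1 / 2)

/-- `f` is in the Hardy class of `D`: it is holomorphic on `D` and its quadratic means over the
circles of radius `r < 1/2` around the centre `1/2` are bounded. -/
def MemHardy (f : ℂ → ℂ) : Prop :=
  DifferentiableOn ℂ f discD ∧
    ∃ C : ℝ, ∀ r : ℝ, 0 ≤ r → r < 1 / 2 → Real.circleAverage (fun z => ‖f z‖ ^ 2) (1 / 2) r ≤ C

lemma sphere_subset_discD {r : ℝ} (h0 : 0 ≤ r) (h1 : r < 1 / 2) :
    Metric.sphere (1 / 2 : ℂ) |r| ⊆ discD := by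
  intro z hz
  rw [abs_of_nonneg h0] at hz
  simp only [discD, Metric.mem_ball, Metric.mem_sphere] at *
  linarith

lemma circleIntegrable_sq {f : ℂ → ℂ} (hf : DifferentiableOn ℂ f discD) {r : ℝ} (h0 : 0 ≤ r)
    (h1 : r < 1 / 2) : CircleIntegrable (fun z => ‖f z‖ ^ 2) (1 / 2) r := by
  apply ContinuousOn.circleIntegrable'
  exact ((hf.continuousOn.mono (sphere_subset_discD h0 h1)).norm).pow 2

lemma MemHardy.add {f g : ℂ → ℂ} (hf : MemHardy f) (hg : MemHardy g) : MemHardy (f + g) := by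
  obtain ⟨hf, C, hC⟩ := hf
  obtain ⟨hg, C', hC'⟩ := hg
  refine ⟨hf.add hg, (2 : ℝ) * C + (2 : ℝ) * C', fun r h0 h1 => ?_⟩
  have i1 := circleIntegrable_sq hf h0 h1
  have i2 := circleIntegrable_sq hg h0 h1
  have j1 : CircleIntegrable ((2 : ℝ) • fun z => ‖f z‖ ^ 2) (1 / 2) r := i1.const_smul
  have j2 : CircleIntegrable ((2 : ℝ) • fun z => ‖g z‖ ^ 2) (1 / 2) r := i2.const_smul
  calc Real.circleAverage (fun z => ‖(f + g) z‖ ^ 2) (1 / 2) r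
      ≤ Real.circleAverage (((2 : ℝ) • fun z => ‖f z‖ ^ 2) + (2 : ℝ) • fun z => ‖g z‖ ^ 2)
          (1 / 2) r := by
        refine Real.circleAverage_mono (circleIntegrable_sq (hf.add hg) h0 h1) (j1.add j2) ?_
        intro z _
        have := norm_add_le (f z) (g z)
        have h3 := norm_nonneg (f z + g z)
        simp only [Pi.add_apply, Pi.smul_apply, smul_eq_mul]
        nlinarith [sq_nonneg (‖f z‖ - ‖g z‖)]
    _ = (2 : ℝ) * Real.circleAverage (fun z => ‖f z‖ ^ 2) (1 / 2) r
          + (2 : ℝ) * Real.circleAverage (fun z => ‖g z‖ ^ 2) (1 / 2) r := by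
        rw [Real.circleAverage_add j1 j2, Real.circleAverage_smul, Real.circleAverage_smul]
        rfl
    _ ≤ _ := by linarith [hC r h0 h1, hC' r h0 h1]

lemma MemHardy.smul (c : ℂ) {f : ℂ → ℂ} (hf : MemHardy f) : MemHardy (c • f) := by
  obtain ⟨hf, C, hC⟩ := hf
  refine ⟨hf.const_smul c, ‖c‖ ^ 2 * C, fun r h0 h1 => ?_⟩
  have : (fun z => ‖(c • f) z‖ ^ 2) = (‖c‖ ^ 2) • fun z => ‖f z‖ ^ 2 := by
    funext z
    simp [mul_pow]
  rw [this, Real.circleAverage_smul, smul_eq_mul]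
  exact mul_le_mul_of_nonneg_left (hC r h0 h1) (by positivity)

lemma memHardy_zero : MemHardy 0 := by
  simpa using (MemHardy.smul 0 (f := fun _ => 0)
    ⟨differentiableOn_const 0, 0, fun r _ _ => by simp [Real.circleAverage_const]⟩)

/-- The Hardy-Hilbert space `H²(D)`, as a complex vector space. A function on `D` is represented
by its extension by `0` to `ℂ`. -/
def hardySpace : Submodule ℂ (ℂ → ℂ) where
  carrier := {f | MemHardy f ∧ ∀ z, z ∉ discD → f z = 0}
  add_mem' := fun {f g} hf hg => ⟨hf.1.add hg.1, fun z hz => by simp [hf.2 z hz, hg.2 z hz]⟩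
  zero_mem' := ⟨memHardy_zero, fun _ _ => rfl⟩
  smul_mem' := fun c f hf => ⟨hf.1.smul c, fun z hz => by simp [hf.2 z hz]⟩

/-- `w_M(z) = (a + c - b - d) z + b + d` for the matrix `M` with rows `(a, b)` and `(c, d)`. -/
def weightFn (M : Matrix (Fin 2) (Fin 2) ℝ) (z : ℂ) : ℂ :=
  ((M 0 0 + M 1 0 - M 0 1 - M 1 1 : ℝ) : ℂ) * z + ((M 0 1 + M 1 1 : ℝ) : ℂ)

/-- `φ_M(z) = ((a - b) z + b) / ((a + c - b - d) z + b + d)`, the projective action of `M`. -/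
def projAction (M : Matrix (Fin 2) (Fin 2) ℝ) (z : ℂ) : ℂ :=
  (((M 0 0 - M 0 1 : ℝ) : ℂ) * z + ((M 0 1 : ℝ) : ℂ)) / weightFn M z

lemma mem_closedBall_iff (z : ℂ) :
    z ∈ Metric.closedBall (1 / 2 : ℂ) (1 / 2) ↔ z.re ^ 2 + z.im ^ 2 ≤ z.re := by
  rw [Metric.mem_closedBall, dist_eq_norm, ← sq_le_sq₀ (norm_nonneg _) (by norm_num),
    ← Complex.normSq_eq_norm_sq, Complex.normSq_apply]
  have h1 : (z - 1 / 2).re = z.re - 1 / 2 := by simp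
  have h2 : (z - 1 / 2).im = z.im := by simp
  rw [h1, h2]
  constructor <;> intro h <;> nlinarith

lemma weight_re_pos {M : Matrix (Fin 2) (Fin 2) ℝ} (hM : ∀ r c, 0 < M r c) {z : ℂ}
    (hz : z ∈ Metric.closedBall (1 / 2 : ℂ) (1 / 2)) : 0 < (weightFn M z).re := by
  rw [mem_closedBall_iff] at hz
  have e : (weightFn M z).re = (M 0 0 + M 1 0) * z.re + (M 0 1 + M 1 1) * (1 - z.re) := by
    simp only [weightFn, Complex.add_re, Complex.re_ofReal_mul, Complex.ofReal_re]
    ring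
  rw [e]
  have h0 : 0 ≤ z.re := by nlinarith [sq_nonneg z.im, sq_nonneg z.re]
  have h1 : z.re ≤ 1 := by nlinarith [sq_nonneg z.im, sq_nonneg z.re]
  have p1 := add_pos (hM 0 0) (hM 1 0)
  have p2 := add_pos (hM 0 1) (hM 1 1)
  rcases h0.eq_or_lt with h | h
  · rw [← h]
    linarith
  · have := mul_pos p1 h
    have := mul_nonneg p2.le (sub_nonneg.2 h1)
    linarith

lemma weight_ne_zero {M : Matrix (Fin 2) (Fin 2) ℝ} (hM : ∀ r c, 0 < M r c) {z : ℂ}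
    (hz : z ∈ Metric.closedBall (1 / 2 : ℂ) (1 / 2)) : weightFn M z ≠ 0 := by
  intro h
  have := weight_re_pos hM hz
  simp [h] at this

/-- `φ_M` maps the closed disc into the open disc. -/
lemma proj_mem_discD {M : Matrix (Fin 2) (Fin 2) ℝ} (hM : ∀ r c, 0 < M r c) {z : ℂ}
    (hz : z ∈ Metric.closedBall (1 / 2 : ℂ) (1 / 2)) : projAction M z ∈ discD := by
  have hw := weight_ne_zero hM hz
  rw [mem_closedBall_iff] at hz
  have e : projAction M z - 1 / 2 =
      (((M 0 0 - M 0 1 - M 1 0 + M 1 1 : ℝ) : ℂ) * z + ((M 0 1 - M 1 1 : ℝ) : ℂ))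
        / (2 * weightFn M z) := by
    rw [projAction]
    field_simp
    rw [weightFn]
    push_cast
    ring
  rw [discD, Metric.mem_ball, dist_eq_norm, e, norm_div, norm_mul,
    div_lt_iff₀ (by have := norm_pos_iff.2 hw; simpa using this)]
  rw [Complex.norm_ofNat, ← mul_assoc, show (1 / 2 * 2 : ℝ) = 1 by norm_num, one_mul,
    ← sq_lt_sq₀ (norm_nonneg _) (norm_nonneg _), ← Complex.normSq_eq_norm_sq,
    ← Complex.normSq_eq_norm_sq, Complex.normSq_apply, Complex.normSq_apply]
  simp only [weightFn, Complex.add_re, Complex.re_ofReal_mul, Complex.ofReal_re, Complex.add_im,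
    Complex.im_ofReal_mul, Complex.ofReal_im]
  have ha := hM 0 0
  have hb := hM 0 1
  have hc := hM 1 0
  have hd := hM 1 1
  generalize M 0 0 = a at *
  generalize M 0 1 = b at *
  generalize M 1 0 = c at *
  generalize M 1 1 = d at *
  generalize z.re = x at *
  generalize z.im = y at *
  have k1 : 0 ≤ a * c * (x ^ 2 + y ^ 2) := by positivity
  have k2 : 0 ≤ b * d * ((1 - x) ^ 2 + y ^ 2) := by positivity
  have k3 : 0 ≤ (a * d + b * c) * (x - (x ^ 2 + y ^ 2)) :=
    mul_nonneg (by positivity) (by linarith)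
  have k4 : 0 < a * c * (x ^ 2 + y ^ 2) + b * d * ((1 - x) ^ 2 + y ^ 2) := by
    by_cases hx : x = 0
    · subst hx
      have : 0 < b * d * ((1 - 0) ^ 2 + y ^ 2) := by positivity
      linarith
    · have : 0 < a * c * (x ^ 2 + y ^ 2) := by positivity
      linarith
  nlinarith

lemma discD_subset_closedBall : discD ⊆ Metric.closedBall (1 / 2 : ℂ) (1 / 2) :=
  Metric.ball_subset_closedBall

/-- The function `z ↦ ∑ p_i w_{A_i}(z)^t f(φ_{A_i}(z))`, where `w ^ t = exp (t log w)` with the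
principal branch of the logarithm, which is holomorphic on the right half plane. -/
def transferFun {k : ℕ} (A : Fin k → Matrix (Fin 2) (Fin 2) ℝ) (p : PMF (Fin k)) (t : ℂ)
    (f : ℂ → ℂ) (z : ℂ) : ℂ :=
  ∑ i, ((p i).toReal : ℂ) * Complex.exp (t * Complex.log (weightFn (A i) z)) * f (projAction (A i) z)

lemma differentiable_weightFn (M : Matrix (Fin 2) (Fin 2) ℝ) : Differentiable ℂ (weightFn M) := by
  unfold weightFn
  fun_prop

lemma differentiableOn_proj {M : Matrix (Fin 2) (Fin 2) ℝ} (hM : ∀ r c, 0 < M r c) :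
    DifferentiableOn ℂ (projAction M) (Metric.closedBall (1 / 2 : ℂ) (1 / 2)) := by
  unfold projAction
  exact DifferentiableOn.div (by fun_prop) (differentiable_weightFn M).differentiableOn
    fun z hz => weight_ne_zero hM hz

lemma differentiableOn_weight_cpow {M : Matrix (Fin 2) (Fin 2) ℝ} (hM : ∀ r c, 0 < M r c) (t : ℂ) :
    DifferentiableOn ℂ (fun z => Complex.exp (t * Complex.log (weightFn M z)))
      (Metric.closedBall (1 / 2 : ℂ) (1 / 2)) := by
  refine DifferentiableOn.cexp (DifferentiableOn.const_mul (DifferentiableOn.clog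
    (differentiable_weightFn M).differentiableOn fun z hz => ?_) t)
  exact Or.inl (weight_re_pos hM hz)

lemma transferFun_differentiableOn {k : ℕ} {A : Fin k → Matrix (Fin 2) (Fin 2) ℝ}
    (hA : ∀ i r c, 0 < A i r c) (p : PMF (Fin k)) (t : ℂ) {f : ℂ → ℂ}
    (hf : DifferentiableOn ℂ f discD) : DifferentiableOn ℂ (transferFun A p t f) discD := by
  unfold transferFun
  refine DifferentiableOn.fun_sum fun i _ => ?_
  refine DifferentiableOn.mul (DifferentiableOn.const_mul
    ((differentiableOn_weight_cpow (hA i) t).mono discD_subset_closedBall) _) ?_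
  exact hf.comp ((differentiableOn_proj (hA i)).mono discD_subset_closedBall)
    fun z hz => proj_mem_discD (hA i) (discD_subset_closedBall hz)

lemma transferFun_continuousOn {k : ℕ} {A : Fin k → Matrix (Fin 2) (Fin 2) ℝ}
    (hA : ∀ i r c, 0 < A i r c) (p : PMF (Fin k)) (t : ℂ) {f : ℂ → ℂ}
    (hf : DifferentiableOn ℂ f discD) :
    ContinuousOn (transferFun A p t f) (Metric.closedBall (1 / 2 : ℂ) (1 / 2)) := by
  unfold transferFun
  refine continuousOn_finsetSum _ fun i _ => ?_
  refine ContinuousOn.mul (ContinuousOn.mul continuousOn_const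
    (differentiableOn_weight_cpow (hA i) t).continuousOn) ?_
  exact hf.continuousOn.comp (differentiableOn_proj (hA i)).continuousOn
    fun z hz => proj_mem_discD (hA i) hz

lemma transfer_mem {k : ℕ} {A : Fin k → Matrix (Fin 2) (Fin 2) ℝ}
    (hA : ∀ i r c, 0 < A i r c) (p : PMF (Fin k)) (t : ℂ) {f : ℂ → ℂ} (hf : f ∈ hardySpace) :
    discD.indicator (transferFun A p t f) ∈ hardySpace := by
  have hd := transferFun_differentiableOn hA p t hf.1.1
  have hd' : DifferentiableOn ℂ (discD.indicator (transferFun A p t f)) discD :=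
    hd.congr fun z hz => Set.indicator_of_mem hz _
  obtain ⟨C, hC⟩ := (isCompact_closedBall (1 / 2 : ℂ) (1 / 2)).exists_bound_of_continuousOn
    (transferFun_continuousOn hA p t hf.1.1)
  refine ⟨⟨hd', C ^ 2, fun r h0 h1 => ?_⟩, fun z hz => Set.indicator_of_notMem hz _⟩
  refine Real.circleAverage_mono_on_of_le_circle (circleIntegrable_sq hd' h0 h1) fun z hz => ?_
  have hz' := sphere_subset_discD h0 h1 hz
  rw [Set.indicator_of_mem hz']
  exact pow_le_pow_left₀ (norm_nonneg _) (hC z (discD_subset_closedBall hz')) 2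

/-- The transfer operator `𝓛_t : H²(D) → H²(D)`,
`(𝓛_t f)(z) = ∑ p_i w_{A_i}(z)^t f(φ_{A_i}(z))` for `z` in `D`. -/
def transferOperator {k : ℕ} (A : Fin k → Matrix (Fin 2) (Fin 2) ℝ)
    (hA : ∀ i r c, 0 < A i r c) (p : PMF (Fin k)) (t : ℂ) : Module.End ℂ hardySpace where
  toFun f := ⟨discD.indicator (transferFun A p t f), transfer_mem hA p t f.2⟩
  map_add' f g := by
    ext z
    by_cases hz : z ∈ discD
    · simp [hz, transferFun, mul_add, Finset.sum_add_distrib]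
    · simp [hz]
  map_smul' c f := by
    ext z
    by_cases hz : z ∈ discD
    · simp [hz, transferFun, Finset.mul_sum, mul_left_comm]
    · simp [hz]

/-- `μ` is the top eigenvalue of `L`: it is an algebraically simple eigenvalue, and every other
eigenvalue has strictly smaller modulus. -/
def IsTopEigenvalue {V : Type*} [AddCommGroup V] [Module ℂ V] (L : Module.End ℂ V) (μ : ℂ) :
    Prop :=
  L.HasEigenvalue μ ∧ Module.finrank ℂ (L.maxGenEigenspace μ) = 1 ∧
    ∀ ν : ℂ, L.HasEigenvalue ν → ν ≠ μ → ‖ν‖ < ‖μ‖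

/-- The Bernoulli measure on `{1, …, k}^ℕ` associated to the probability vector `p`. -/
def bernoulliMeasure {k : ℕ} (p : PMF (Fin k)) : Measure (ℕ → Fin k) :=
  Measure.infinitePi fun _ : ℕ => p.toMeasure

/-- `Λ` is the Lyapunov exponent of the Bernoulli measure: the limit of
`(1/n) ∫ log ‖A_{i_1} ⋯ A_{i_n}‖ dμ_p(i)`, with the Euclidean operator norm. -/
def IsLyapunovExponent {k : ℕ} (A : Fin k → Matrix (Fin 2) (Fin 2) ℝ) (p : PMF (Fin k))
    (Λ : ℝ) : Prop :=
  Tendsto (fun n : ℕ => (1 / (n : ℝ)) * ∫ ω, Real.log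
    ‖Matrix.toEuclideanCLM (𝕜 := ℝ) (List.ofFn fun j : Fin n => A (ω j)).prod‖
      ∂(bernoulliMeasure p)) atTop (𝓝 Λ)

end

/-! The operator on `H²(D)` factors as `L = J T`: since every `φ_{A_i}` sends the closed disc into
`D`, `T` lands in the disc algebra, and `J` is the inclusion. Nonzero eigenvalues, with their
multiplicity, are therefore those of `S = T J`, the same transfer operator on the disc algebra
(`isTopEigenvalue_of_intertwining`). There multiplication by `exp (t log w)` is norm-analytic in
`t`, so `t ↦ S_t` is entire.

At `t = 0` the constants are fixed. Modulo constants `S_0` contracts the Bloch seminorm by the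
Schwarz–Pick factor `max |ad - bc| / (ad + bc) < 1`, and it is bounded from that seminorm to the sup
norm, so a power of the deflated operator has norm `< 1`
(`exists_norm_deflatedTransfer_pow_lt_one`). The implicit function theorem then continues the
eigenpair `(1, 1)` holomorphically, and the norm gap persists, which gives simplicity and dominance
(`exists_dominant_eigenvalue`).

Differentiating `S_t h_t = λ_t h_t` at `0` gives `∑ p_i log w_{A_i} = λ'(0) + v - S_0 v`. The weight
is a multiplicative cocycle, so the mean of `log w` over words of length `n` telescopes to `n λ'(0)
+ O(1)` (`wordMeanLog_eq`). At the centre `1/2` the weight of `M` is half the sum of its entries,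
which is the operator norm up to a factor `2`. Dividing by `n` shows both that the Lyapunov limit
exists and that it equals `λ'(0)`. -/

noncomputable section

/-! ### Perturbation of a simple dominant eigenvalue. -/

section Perturbation

variable {X : Type*} [NormedAddCommGroup X] [NormedSpace ℂ X]

/-- The operator `L` followed by the projection onto `ker l` along `h` (when `l h = 1`). -/
def deflation (L : X →L[ℂ] X) (l : X →L[ℂ] ℂ) (h : X) : X →L[ℂ] X :=
  L - (l.comp L).smulRight h

lemma deflation_apply (L : X →L[ℂ] X) (l : X →L[ℂ] ℂ) (h f : X) :
    deflation L l h f = L f - l (L f) • h := by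
  simp [deflation]

lemma pow_apply_of_apply_eq_smul {P : X →L[ℂ] X} {f : X} {ν : ℂ} (hf : P f = ν • f) (n : ℕ) :
    (P ^ n) f = ν ^ n • f := by
  induction n with
  | zero => simp
  | succ n ih => rw [pow_succ, mul_apply_eq_comp, hf, map_smul, ih, smul_smul, pow_succ,
      mul_comm]

lemma eq_zero_or_norm_pow_le {P : X →L[ℂ] X} {f : X} {ν : ℂ} (hf : P f = ν • f) (n : ℕ) :
    f = 0 ∨ ‖ν‖ ^ n ≤ ‖P ^ n‖ := by
  by_cases h : f = 0
  · exact Or.inl h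
  right
  have := (P ^ n).le_opNorm f
  rw [pow_apply_of_apply_eq_smul hf, norm_smul, norm_pow] at this
  exact le_of_mul_le_mul_right this (norm_pos_iff.2 h)

/-- A deflated generalised eigenvector is a generalised eigenvector of the deflated operator. -/
lemma deflation_apply_sub {L : X →L[ℂ] X} {l : X →L[ℂ] ℂ} {h f : X} {μ ν c : ℂ}
    (hh : L h = μ • h) (hl : l h = 1) (hf : L f = ν • f + c • h) :
    deflation L l h (f - l f • h) = ν • (f - l f • h) := by
  simp only [deflation_apply, map_sub, map_smul, hh, hf, map_add, hl, smul_eq_mul]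
  module

/-- `1 - P` is a factor of the invertible `1 - P ^ n`, and the cofactor `∑ P ^ i` commutes with it.
-/
lemma isUnit_one_sub_of_norm_pow_lt_one [CompleteSpace X] {P : X →L[ℂ] X} {n : ℕ}
    (hP : ‖P ^ n‖ < 1) : IsUnit (1 - P) := by
  have h1 : IsUnit (1 - P ^ n) := isUnit_one_sub_of_norm_lt_one hP
  rw [← mul_neg_geom_sum] at h1
  have hc : Commute (1 - P) (∑ i ∈ Finset.range n, P ^ i) :=
    Commute.sum_right _ _ _ fun i _ =>
      ((Commute.one_left P).sub_left (Commute.refl P)).pow_right i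
  exact (hc.isUnit_mul_iff.1 h1).1

/-- Perturbation of a dominant simple eigenvalue of an analytic family of operators. -/
theorem exists_dominant_eigenvalue [CompleteSpace X] {L : ℂ → X →L[ℂ] X} (hL : Differentiable ℂ L)
    {u : X} {l : X →L[ℂ] ℂ} (hlu : l u = 1) (hu : L 0 u = u) {n : ℕ}
    (hn : ‖deflation (L 0) l u ^ n‖ < 1) :
    ∃ (U : Set ℂ) (h : ℂ → X), IsOpen U ∧ (0 : ℂ) ∈ U ∧ DifferentiableOn ℂ h U ∧ h 0 = u ∧
      ∀ t ∈ U, l (h t) = 1 ∧ L t (h t) = l (L t (h t)) • h t ∧ l (L t (h t)) ≠ 0 ∧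
        (∀ (ν : ℂ) (f : X), L t f = ν • f → f ≠ 0 → ν ≠ l (L t (h t)) → ‖ν‖ < ‖l (L t (h t))‖) ∧
        ∀ (c : ℂ) (f : X), L t f = l (L t (h t)) • f + c • h t → ∃ a : ℂ, f = a • h t := by
  -- A zero `(t, x)` of `F` satisfies the eigenvector equation with eigenvalue `l (L t x)`. The
  -- normalisation `l x = 1` is not imposed; it follows when that eigenvalue is nonzero.
  let F : ℂ × X → X := fun x => l (L x.1 x.2) • x.2 - L x.1 x.2
  have hLc : ContDiff ℂ 1 L := hL.contDiff
  have hF : ContDiff ℂ 1 F := by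
    have h1 : ContDiff ℂ 1 fun x : ℂ × X => L x.1 x.2 :=
      (hLc.comp contDiff_fst).clm_apply contDiff_snd
    exact ((l.contDiff.comp h1).smul contDiff_snd).sub h1
  have hF0 : F (0, u) = 0 := by simp [F, hu, hlu]
  -- Since `l (L 0 u) = 1`, the derivative in a direction `k` is `l (L 0 k) u + k - L 0 k`.
  have hd : (fderiv ℂ F (0, u)).comp (.inr ℂ ℂ X) = 1 - deflation (L 0) l u := by
    have e1 : HasFDerivAt (fun y => F (0, y)) ((fderiv ℂ F (0, u)).comp (.inr ℂ ℂ X)) u :=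
      HasFDerivAt.comp u (f := fun y : X => ((0 : ℂ), y))
        ((hF.differentiable one_ne_zero) (0, u)).hasFDerivAt
        (hasFDerivAt_prodMk_right (0 : ℂ) u)
    have e2 : HasFDerivAt (fun y => F (0, y)) (1 - deflation (L 0) l u) u := by
      have a1 : HasFDerivAt (fun y => l (L 0 y)) (l.comp (L 0)) u := (l.comp (L 0)).hasFDerivAt
      have a2 := (a1.smul (hasFDerivAt_id u)).sub (L 0).hasFDerivAt
      convert! a2 using 1
      ext k
      simp [deflation_apply, hu, hlu]
      abel
    exact e1.unique e2
  have hinv : ((fderiv ℂ F (0, u)).comp (.inr ℂ ℂ X)).IsInvertible := by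
    rw [hd]
    obtain ⟨v, hv⟩ := isUnit_one_sub_of_norm_pow_lt_one hn
    exact ⟨ContinuousLinearEquiv.unitsEquiv ℂ X v, by rw [← hv]; rfl⟩
  have cdf : ContDiffAt ℂ 1 F (0, u) := hF.contDiffAt
  let h := cdf.implicitFunction one_ne_zero hinv
  have hh0 : h 0 = u := cdf.implicitFunction_apply_self one_ne_zero hinv
  have hhF : ∀ᶠ t in 𝓝 (0 : ℂ), F (t, h t) = 0 := by
    have := cdf.eventually_apply_implicitFunction one_ne_zero hinv
    rwa [hF0] at this
  have hcd : ContDiffAt ℂ 1 h 0 := cdf.contDiffAt_implicitFunction one_ne_zero hinv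
  have hhd : ∀ᶠ t in 𝓝 (0 : ℂ), DifferentiableAt ℂ h t :=
    (hcd.eventually (by simp)).mono fun t ht => ht.differentiableAt one_ne_zero
  have hLh : ContinuousAt (fun t => L t (h t)) 0 :=
    hL.continuous.continuousAt.clm_apply hcd.continuousAt
  have heig : ContinuousAt (fun t => l (L t (h t))) 0 := l.continuous.continuousAt.comp hLh
  have heig0 : l (L 0 (h 0)) = 1 := by rw [hh0, hu, hlu]
  -- The threshold `r` separates the `n`-th power of the deflated operator from the `n`-th power of
  -- the eigenvalue; both strict inequalities are open in `t`.
  obtain ⟨r, hr1, hr2⟩ := exists_between hn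
  have hne : ∀ᶠ t in 𝓝 (0 : ℂ), l (L t (h t)) ≠ 0 :=
    heig.eventually_ne (by rw [heig0]; exact one_ne_zero)
  have hbig : ∀ᶠ t in 𝓝 (0 : ℂ), r < ‖l (L t (h t))‖ ^ n := by
    refine (heig.norm.pow n).eventually_const_lt ?_
    rw [Pi.pow_apply, heig0]
    simpa using hr2
  have hsmall : ∀ᶠ t in 𝓝 (0 : ℂ), ‖deflation (L t) l (h t) ^ n‖ < r := by
    have hc : ContinuousAt (fun t => deflation (L t) l (h t)) 0 := by
      unfold deflation
      refine hL.continuous.continuousAt.sub ?_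
      have c1 : ContinuousAt (fun t => l.comp (L t)) 0 :=
        (continuous_const.clm_comp hL.continuous).continuousAt
      exact ((ContinuousLinearMap.smulRightL ℂ X X).continuous.continuousAt.comp c1).clm_apply
        hcd.continuousAt
    refine (hc.pow n).norm.eventually_lt_const ?_
    simpa only [Pi.pow_apply, hh0] using hr1
  obtain ⟨U, hU, hUo, hU0⟩ := eventually_nhds_iff.1
    (((hhF.and hhd).and (hne.and hbig)).and hsmall)
  refine ⟨U, h, hUo, hU0, fun t ht => (hU t ht).1.1.2.differentiableWithinAt, hh0, fun t ht => ?_⟩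
  obtain ⟨⟨⟨h1, -⟩, h2, h3⟩, h4⟩ := hU t ht
  have hev : L t (h t) = l (L t (h t)) • h t := (sub_eq_zero.1 h1).symm
  have hlh : l (h t) = 1 := by
    have := congrArg l hev
    rw [map_smul, smul_eq_mul] at this
    exact (mul_eq_left₀ h2).1 this.symm
  refine ⟨hlh, hev, h2, fun ν f hf hf0 hν => ?_, fun c f hf => ⟨l f, ?_⟩⟩
  -- Either `f` is a multiple of `h t`, which forces `ν` to be the chosen eigenvalue, or `ν` is an
  -- eigenvalue of the deflated operator and `‖ν‖ ^ n < r`.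
  · have k1 : deflation (L t) l (h t) (f - l f • h t) = ν • (f - l f • h t) :=
      deflation_apply_sub (c := 0) hev hlh (by simpa using hf)
    rcases eq_zero_or_norm_pow_le k1 n with k2 | k2
    · exfalso
      have k3 := sub_eq_zero.1 k2
      have k4 : ν • f = l (L t (h t)) • f := by
        rw [← hf, k3, map_smul, hev, smul_comm, map_smul, hlh, smul_eq_mul, mul_one]
      exact hν (smul_left_injective ℂ hf0 k4)
    · exact lt_of_pow_lt_pow_left₀ n (norm_nonneg _) (by linarith)
  -- The same alternative with `ν` the eigenvalue itself; now the second case contradicts the choice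
  -- of `r`, so there is no Jordan block.
  · have k1 := deflation_apply_sub hev hlh hf
    rcases eq_zero_or_norm_pow_le k1 n with k2 | k2
    · exact sub_eq_zero.1 k2
    · linarith

/-- First order perturbation theory: the derivative of `L` at the eigenvector `u` equals the
derivative of the eigenvalue modulo coboundaries. -/
lemma exists_coboundary_of_eigenvalue {L : ℂ → X →L[ℂ] X} (hL : Differentiable ℂ L) {u w : X}
    {l : X →L[ℂ] ℂ} (hlu : l u = 1) (hu : L 0 u = u) {U : Set ℂ} {h : ℂ → X} (hU : IsOpen U)
    (h0U : (0 : ℂ) ∈ U) (hh : DifferentiableOn ℂ h U) (hh0 : h 0 = u)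
    (hev : ∀ t ∈ U, L t (h t) = l (L t (h t)) • h t) (hw : HasDerivAt (fun t => L t u) w 0) :
    DifferentiableOn ℂ (fun t => l (L t (h t))) U ∧
      ∃ v, w = deriv (fun t => l (L t (h t))) 0 • u + v - L 0 v := by
  have hLh : DifferentiableOn ℂ (fun t => L t (h t)) U := hL.differentiableOn.clm_apply hh
  have heig : DifferentiableOn ℂ (fun t => l (L t (h t))) U :=
    l.differentiable.comp_differentiableOn hLh
  -- The transfer function is `h'(0)`: the product rule gives `w + L 0 h'(0) = λ'(0) u + h'(0)`.
  refine ⟨heig, deriv h 0, ?_⟩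
  have hU0 : U ∈ 𝓝 (0 : ℂ) := hU.mem_nhds h0U
  have dh := (hh.differentiableAt hU0).hasDerivAt
  have de := (heig.differentiableAt hU0).hasDerivAt
  have dL := (hL 0).hasDerivAt
  have hw' : deriv L 0 u = w := by
    have h1 := dL.clm_apply (hasDerivAt_const (0 : ℂ) u)
    rw [map_zero, add_zero] at h1
    exact h1.unique hw
  have h1 := dL.clm_apply dh
  have h2 := (de.smul dh).congr_of_eventuallyEq (eventually_of_mem hU0 hev)
  have h3 := h1.unique h2
  rw [hh0, hw', hu, hlu, one_smul] at h3
  rw [eq_sub_iff_add_eq, h3, add_comm]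

end Perturbation

/-! ### Analytic families of weighted composition-type operators. -/

section WeightedTransfer

variable {B ι : Type*} [NormedCommRing B] [NormedAlgebra ℂ B] [CompleteSpace B] [Fintype ι]

/-- The operator `f ↦ ∑ c_i exp (t g_i) C_i f` on a commutative Banach algebra. -/
def weightedTransfer (c : ι → ℂ) (g : ι → B) (C : ι → B →L[ℂ] B) (t : ℂ) : B →L[ℂ] B :=
  ∑ i, (ContinuousLinearMap.mul ℂ B (c i • NormedSpace.exp (t • g i))).comp (C i)

/-- In a Banach algebra `exp (t g)` is entire in `t`, and the multiplication operator depends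
linearly and boundedly on the multiplier. -/
lemma differentiable_weightedTransfer (c : ι → ℂ) (g : ι → B) (C : ι → B →L[ℂ] B) :
    Differentiable ℂ (weightedTransfer c g C) := by
  unfold weightedTransfer
  refine Differentiable.fun_sum fun i _ => ?_
  have h1 : Differentiable ℂ fun t : ℂ => NormedSpace.exp (t • g i) :=
    differentiable_exp_smul_const ℂ (g i)
  have h2 : Differentiable ℂ fun t : ℂ => ContinuousLinearMap.mul ℂ B
      (c i • NormedSpace.exp (t • g i)) :=
    (ContinuousLinearMap.mul ℂ B).differentiable.comp (h1.const_smul (c i))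
  exact h2.clm_comp (differentiable_const _)

lemma hasDerivAt_weightedTransfer (c : ι → ℂ) (g : ι → B) (C : ι → B →L[ℂ] B) (f : B) :
    HasDerivAt (fun t => weightedTransfer c g C t f) (∑ i, c i • (g i * C i f)) 0 := by
  have e : (fun t => weightedTransfer c g C t f) = fun t =>
      ∑ i, c i • (NormedSpace.exp (t • g i) * C i f) := by
    funext t
    simp [weightedTransfer, sum_apply]
  rw [e]
  refine HasDerivAt.fun_sum fun i _ => ?_
  have h := ((hasDerivAt_exp_smul_const' (𝕂 := ℂ) (g i) (0 : ℂ)).mul_const (C i f)).const_smul (c i)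
  simp only [zero_smul, NormedSpace.exp_zero, mul_one] at h
  exact h

/-- A continuous character commutes with the exponential series; applied to point evaluations, this
recovers the pointwise formula. -/
lemma map_weightedTransfer (e : B →ₐ[ℂ] ℂ) (he : Continuous e) (c : ι → ℂ) (g : ι → B)
    (C : ι → B →L[ℂ] B) (t : ℂ) (f : B) :
    e (weightedTransfer c g C t f) = ∑ i, c i * Complex.exp (t * e (g i)) * e (C i f) := by
  have h : ∀ x : B, e (NormedSpace.exp x) = Complex.exp (e x) := fun x => by
    rw [Complex.exp_eq_exp_ℂ]
    let _ : NormedAlgebra ℚ B := NormedAlgebra.restrictScalars ℚ ℂ B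
    exact NormedSpace.map_exp e he x
  simp [weightedTransfer, sum_apply, h, mul_assoc]

end WeightedTransfer

/-! ### The disc algebra and the transfer operator on it. -/

section DiscAlgebra

/-- The closed disc of radius `1/2` centred at `1/2`. -/
abbrev closedDisc : Set ℂ := Metric.closedBall (1 / 2 : ℂ) (1 / 2)

/-- The extension by zero of a function on the closed disc. -/
def zeroExtend (f : closedDisc → ℂ) : ℂ → ℂ := Function.extend Subtype.val f 0

lemma zeroExtend_apply (f : closedDisc → ℂ) {z : ℂ} (hz : z ∈ closedDisc) :
    zeroExtend f z = f ⟨z, hz⟩ :=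
  Subtype.val_injective.extend_apply f 0 (⟨z, hz⟩ : closedDisc)

lemma zeroExtend_of_mem_discD (f : closedDisc → ℂ) {z : ℂ} (hz : z ∈ discD) :
    zeroExtend f z = f ⟨z, discD_subset_closedBall hz⟩ :=
  zeroExtend_apply f _

lemma isOpen_discD : IsOpen discD := Metric.isOpen_ball

/-- The disc algebra: continuous functions on the closed disc, holomorphic inside. -/
def discAlgebra : Subalgebra ℂ C(closedDisc, ℂ) where
  carrier := {f | DifferentiableOn ℂ (zeroExtend f) discD}
  mul_mem' {f g} hf hg := (DifferentiableOn.mul hf hg).congr fun z hz => by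
    simp [zeroExtend_of_mem_discD _ hz]
  add_mem' {f g} hf hg := (DifferentiableOn.add hf hg).congr fun z hz => by
    simp [zeroExtend_of_mem_discD _ hz]
  algebraMap_mem' c := (differentiableOn_const c).congr fun z hz => by
    simp [zeroExtend_of_mem_discD _ hz]

/-- Uniform limits of holomorphic functions are holomorphic. Completeness is what the implicit
function theorem and the exponential need. -/
lemma isClosed_discAlgebra : IsClosed (discAlgebra : Set C(closedDisc, ℂ)) := by
  refine isClosed_of_closure_subset fun f hf => ?_
  obtain ⟨s, hs, hsf⟩ := mem_closure_iff_seq_limit.1 hf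
  have h1 := ContinuousMap.tendsto_iff_tendstoUniformly.1 hsf
  refine TendstoLocallyUniformlyOn.differentiableOn (F := fun n => zeroExtend (s n))
    (φ := atTop) (TendstoUniformlyOn.tendstoLocallyUniformlyOn ?_)
    (Eventually.of_forall hs) isOpen_discD
  rw [Metric.tendstoUniformlyOn_iff]
  rw [Metric.tendstoUniformly_iff] at h1
  intro ε hε
  filter_upwards [h1 ε hε] with n hn z hz
  rw [zeroExtend_of_mem_discD _ hz, zeroExtend_of_mem_discD _ hz]
  exact hn _

instance : CompleteSpace discAlgebra := isClosed_discAlgebra.completeSpace_coe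

/-- A function that is continuous on the closed disc and holomorphic inside, as an element of the
disc algebra. -/
def toDiscAlgebra (F : ℂ → ℂ) (hc : ContinuousOn F closedDisc) (hd : DifferentiableOn ℂ F discD) :
    discAlgebra :=
  ⟨⟨closedDisc.domRestrict F, hc.domRestrict⟩, hd.congr fun z hz => by
    rw [zeroExtend_of_mem_discD _ hz]; rfl⟩

lemma norm_apply_le (f : discAlgebra) (z : closedDisc) : ‖f.1 z‖ ≤ ‖f‖ :=
  f.1.norm_coe_le_norm z

lemma norm_le_of_forall {f : discAlgebra} {C : ℝ} (hC : 0 ≤ C) (h : ∀ z, ‖f.1 z‖ ≤ C) : ‖f‖ ≤ C :=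
  (ContinuousMap.norm_le f.1 hC).2 h

lemma discAlgebra_ext {f g : discAlgebra} (h : ∀ z, f.1 z = g.1 z) : f = g :=
  Subtype.ext (ContinuousMap.ext h)

/-- Evaluation at a point of the closed disc. -/
def evalAt (z : closedDisc) : discAlgebra →L[ℂ] ℂ :=
  LinearMap.mkContinuous
    { toFun := fun f => f.1 z
      map_add' := fun _ _ => rfl
      map_smul' := fun _ _ => rfl } 1 fun f => by
        rw [one_mul]
        exact norm_apply_le f z

@[simp] lemma evalAt_apply (z : closedDisc) (f : discAlgebra) : evalAt z f = f.1 z := rfl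

variable {M : Matrix (Fin 2) (Fin 2) ℝ}

/-- The projective action as a self-map of the closed disc. -/
def projMap (hM : ∀ r c, 0 < M r c) : C(closedDisc, closedDisc) where
  toFun z := ⟨projAction M z, discD_subset_closedBall (proj_mem_discD hM z.2)⟩
  continuous_toFun := ((differentiableOn_proj hM).continuousOn.domRestrict).subtype_mk _

@[simp] lemma projMap_coe (hM : ∀ r c, 0 < M r c) (z : closedDisc) :
    (projMap hM z : ℂ) = projAction M z := rfl

/-- Composition with the projective action. -/
def compProj (hM : ∀ r c, 0 < M r c) : discAlgebra →L[ℂ] discAlgebra :=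
  LinearMap.mkContinuous
    { toFun := fun f => ⟨f.1.comp (projMap hM), by
        have h : DifferentiableOn ℂ (fun z => zeroExtend f.1 (projAction M z)) discD :=
          DifferentiableOn.comp f.2 ((differentiableOn_proj hM).mono discD_subset_closedBall)
            fun z hz => proj_mem_discD hM (discD_subset_closedBall hz)
        refine h.congr fun z hz => ?_
        rw [zeroExtend_of_mem_discD _ hz,
          zeroExtend_of_mem_discD _ (proj_mem_discD hM (discD_subset_closedBall hz))]
        rfl⟩
      map_add' := fun _ _ => rfl
      map_smul' := fun _ _ => rfl } 1 fun f => by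
        rw [one_mul]
        exact norm_le_of_forall (norm_nonneg _) fun z => norm_apply_le f _

/-- The logarithm of the weight as an element of the disc algebra. -/
def logWeight (hM : ∀ r c, 0 < M r c) : discAlgebra :=
  have h : DifferentiableOn ℂ (fun z => Complex.log (weightFn M z)) closedDisc :=
    (differentiable_weightFn M).differentiableOn.clog fun _ hz => Or.inl (weight_re_pos hM hz)
  toDiscAlgebra _ h.continuousOn (h.mono discD_subset_closedBall)

/-- Evaluation at a point of the closed disc, as an algebra homomorphism. -/
def evalHom (z : closedDisc) : discAlgebra →ₐ[ℂ] ℂ where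
  toFun f := f.1 z
  map_zero' := rfl
  map_one' := rfl
  map_add' _ _ := rfl
  map_mul' _ _ := rfl
  commutes' _ := rfl

variable {k : ℕ} {A : Fin k → Matrix (Fin 2) (Fin 2) ℝ}

/-- The transfer operator on the disc algebra. -/
def discTransfer (hA : ∀ i r c, 0 < A i r c) (p : PMF (Fin k)) (t : ℂ) :
    discAlgebra →L[ℂ] discAlgebra :=
  weightedTransfer (fun i => ((p i).toReal : ℂ)) (fun i => logWeight (hA i))
    (fun i => compProj (hA i)) t

lemma discTransfer_apply (hA : ∀ i r c, 0 < A i r c) (p : PMF (Fin k)) (t : ℂ) (f : discAlgebra)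
    (z : closedDisc) :
    (discTransfer hA p t f).1 z = ∑ i, ((p i).toReal : ℂ) *
      Complex.exp (t * Complex.log (weightFn (A i) z)) * f.1 (projMap (hA i) z) := by
  exact map_weightedTransfer (evalHom z) (evalAt z).continuous _ _ _ t f

lemma differentiable_discTransfer (hA : ∀ i r c, 0 < A i r c) (p : PMF (Fin k)) :
    Differentiable ℂ (discTransfer hA p) :=
  differentiable_weightedTransfer _ _ _

/-- The average logarithm of the weights. -/
def meanLogWeight (hA : ∀ i r c, 0 < A i r c) (p : PMF (Fin k)) : discAlgebra :=
  ∑ i, ((p i).toReal : ℂ) • logWeight (hA i)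

lemma meanLogWeight_apply (hA : ∀ i r c, 0 < A i r c) (p : PMF (Fin k)) (z : closedDisc) :
    (meanLogWeight hA p).1 z = ∑ i, ((p i).toReal : ℂ) * Complex.log (weightFn (A i) z) := by
  rw [meanLogWeight, ← evalAt_apply, map_sum]
  rfl

lemma hasDerivAt_discTransfer_one (hA : ∀ i r c, 0 < A i r c) (p : PMF (Fin k)) :
    HasDerivAt (fun t => discTransfer hA p t 1) (meanLogWeight hA p) 0 := by
  have h := hasDerivAt_weightedTransfer (fun i => ((p i).toReal : ℂ)) (fun i => logWeight (hA i))
    (fun i => compProj (hA i)) 1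
  have e : ∀ i, compProj (hA i) 1 = 1 := fun i => rfl
  simp only [e, mul_one] at h
  exact h

lemma sum_toReal_pmf (p : PMF (Fin k)) : ∑ i, (p i).toReal = 1 := by
  rw [← ENNReal.toReal_sum fun i _ => p.apply_ne_top i, ← tsum_fintype (L := .unconditional _),
    p.tsum_coe, ENNReal.toReal_one]

lemma discTransfer_zero_apply (hA : ∀ i r c, 0 < A i r c) (p : PMF (Fin k)) (f : discAlgebra)
    (z : closedDisc) :
    (discTransfer hA p 0 f).1 z = ∑ i, ((p i).toReal : ℂ) * f.1 (projMap (hA i) z) := by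
  simp [discTransfer_apply]

lemma discTransfer_zero_one (hA : ∀ i r c, 0 < A i r c) (p : PMF (Fin k)) :
    discTransfer hA p 0 1 = 1 := by
  refine discAlgebra_ext fun z => ?_
  rw [discTransfer_zero_apply]
  have : ∑ i, ((p i).toReal : ℂ) = 1 := by exact_mod_cast sum_toReal_pmf p
  simpa using this

end DiscAlgebra

/-! ### Schwarz–Pick contraction in the Bloch seminorm. -/

section Contraction

/-- The reciprocal of the density of the hyperbolic metric of the disc, up to a constant. -/
def hypWeight (z : ℂ) : ℝ := 1 / 4 - ‖z - 1 / 2‖ ^ 2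

lemma hypWeight_eq (z : ℂ) : hypWeight z = z.re - (z.re ^ 2 + z.im ^ 2) := by
  have h1 : (z - 1 / 2).re = z.re - 1 / 2 := by simp
  have h2 : (z - 1 / 2).im = z.im := by simp
  rw [hypWeight, ← Complex.normSq_eq_norm_sq, Complex.normSq_apply, h1, h2]
  ring

lemma hypWeight_pos {z : ℂ} (hz : z ∈ discD) : 0 < hypWeight z := by
  rw [discD, Metric.mem_ball, dist_eq_norm] at hz
  rw [hypWeight]
  nlinarith [norm_nonneg (z - 1 / 2)]

variable {M : Matrix (Fin 2) (Fin 2) ℝ}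

lemma hasDerivAt_projAction {z : ℂ} (hw : weightFn M z ≠ 0) :
    HasDerivAt (projAction M) ((M.det : ℂ) / weightFn M z ^ 2) z := by
  have h1 : HasDerivAt (weightFn M) ((M 0 0 + M 1 0 - M 0 1 - M 1 1 : ℝ) : ℂ) z := by
    have h := ((hasDerivAt_id z).const_mul ((M 0 0 + M 1 0 - M 0 1 - M 1 1 : ℝ) : ℂ)).add_const
      ((M 0 1 + M 1 1 : ℝ) : ℂ)
    rw [mul_one] at h
    exact h
  have h2 : HasDerivAt (fun z => ((M 0 0 - M 0 1 : ℝ) : ℂ) * z + ((M 0 1 : ℝ) : ℂ))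
      ((M 0 0 - M 0 1 : ℝ) : ℂ) z := by
    simpa using ((hasDerivAt_id z).const_mul ((M 0 0 - M 0 1 : ℝ) : ℂ)).add_const
      ((M 0 1 : ℝ) : ℂ)
  convert! h2.div h1 hw using 1
  rw [Matrix.det_fin_two, weightFn]
  push_cast
  ring

/-- A direct expansion. The first two terms on the right are nonnegative for positive entries;
dropping them leaves the factor `ad + bc` of the contraction rate. -/
lemma hypWeight_projAction_mul {z : ℂ} (hw : weightFn M z ≠ 0) :
    hypWeight (projAction M z) * ‖weightFn M z‖ ^ 2 =
      M 0 0 * M 1 0 * (z.re ^ 2 + z.im ^ 2) + M 0 1 * M 1 1 * ((1 - z.re) ^ 2 + z.im ^ 2) +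
        (M 0 0 * M 1 1 + M 0 1 * M 1 0) * hypWeight z := by
  have e : projAction M z - 1 / 2 =
      (((M 0 0 - M 0 1 - M 1 0 + M 1 1 : ℝ) : ℂ) * z + ((M 0 1 - M 1 1 : ℝ) : ℂ))
        / (2 * weightFn M z) := by
    rw [projAction]
    field_simp
    rw [weightFn]
    push_cast
    ring
  have hn : ‖weightFn M z‖ ≠ 0 := norm_ne_zero_iff.2 hw
  have e2 : hypWeight (projAction M z) * ‖weightFn M z‖ ^ 2 = (‖weightFn M z‖ ^ 2 -
      ‖((M 0 0 - M 0 1 - M 1 0 + M 1 1 : ℝ) : ℂ) * z + ((M 0 1 - M 1 1 : ℝ) : ℂ)‖ ^ 2) / 4 := by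
    rw [hypWeight, e, norm_div, norm_mul, Complex.norm_ofNat]
    field_simp
    ring
  rw [e2, hypWeight_eq, ← Complex.normSq_eq_norm_sq, ← Complex.normSq_eq_norm_sq,
    Complex.normSq_apply, Complex.normSq_apply]
  simp only [weightFn, Complex.add_re, Complex.re_ofReal_mul, Complex.ofReal_re, Complex.add_im,
    Complex.im_ofReal_mul, Complex.ofReal_im]
  ring

/-- Quantitative Schwarz–Pick: the derivative of `φ_M` is `det M / w_M ^ 2`, so the factors `‖w_M‖ ^
2` cancel and `|ad - bc|` is compared with `ad + bc`. -/
lemma hypWeight_mul_norm_deriv_le (hM : ∀ r c, 0 < M r c) {κ : ℝ}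
    (hκ : |M.det| ≤ κ * (M 0 0 * M 1 1 + M 0 1 * M 1 0)) (hκ0 : 0 ≤ κ) {z : ℂ}
    (hz : z ∈ discD) :
    hypWeight z * ‖(M.det : ℂ) / weightFn M z ^ 2‖ ≤ κ * hypWeight (projAction M z) := by
  have hw := weight_ne_zero hM (discD_subset_closedBall hz)
  have hn : 0 < ‖weightFn M z‖ ^ 2 := by positivity
  rw [norm_div, norm_pow, Complex.norm_real, Real.norm_eq_abs, ← mul_div_assoc, div_le_iff₀ hn,
    mul_assoc, hypWeight_projAction_mul hw]
  have ha := hM 0 0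
  have hb := hM 0 1
  have hc := hM 1 0
  have hd := hM 1 1
  have hp := hypWeight_pos hz
  calc hypWeight z * |M.det|
      ≤ hypWeight z * (κ * (M 0 0 * M 1 1 + M 0 1 * M 1 0)) := by gcongr
    _ = κ * (0 + 0 + (M 0 0 * M 1 1 + M 0 1 * M 1 0) * hypWeight z) := by ring
    _ ≤ _ := by gcongr <;> positivity

/-- `C` bounds the Bloch seminorm of `f`. -/
def BlochBound (f : discAlgebra) (C : ℝ) : Prop :=
  ∀ z ∈ discD, hypWeight z * ‖deriv (zeroExtend f.1) z‖ ≤ C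

lemma hasDerivAt_zeroExtend (f : discAlgebra) {z : ℂ} (hz : z ∈ discD) :
    HasDerivAt (zeroExtend f.1) (deriv (zeroExtend f.1) z) z :=
  (f.2.differentiableAt (isOpen_discD.mem_nhds hz)).hasDerivAt

lemma BlochBound.nonneg {f : discAlgebra} {C : ℝ} (h : BlochBound f C) : 0 ≤ C := by
  have hz : (1 / 2 : ℂ) ∈ discD := Metric.mem_ball_self (by norm_num)
  exact (mul_nonneg (hypWeight_pos hz).le (norm_nonneg _)).trans (h _ hz)

/-- Cauchy's estimate. -/
lemma hypWeight_mul_norm_deriv_le_of_bound {F : ℂ → ℂ} (hF : DifferentiableOn ℂ F discD) {C : ℝ}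
    (hC : ∀ z ∈ discD, ‖F z‖ ≤ C) {z : ℂ} (hz : z ∈ discD) :
    hypWeight z * ‖deriv F z‖ ≤ 2 * C := by
  have hz' : ‖z - 1 / 2‖ < 1 / 2 := by simpa [discD, dist_eq_norm] using hz
  set δ := 1 / 2 - ‖z - 1 / 2‖ with hδ
  -- Half the distance to the boundary, so that the closed disc of this radius stays in `D`; this is
  -- the source of the constant `2`.
  have hδ0 : 0 < δ / 2 := by rw [hδ]; linarith
  have hC0 : 0 ≤ C := (norm_nonneg _).trans (hC z hz)
  have hsub : Metric.closedBall z (δ / 2) ⊆ discD := by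
    intro w hw
    rw [Metric.mem_closedBall] at hw
    rw [discD, Metric.mem_ball]
    have := dist_triangle w z (1 / 2)
    rw [dist_eq_norm z] at this
    linarith
  have hd : DiffContOnCl ℂ F (Metric.ball z (δ / 2)) := by
    refine DifferentiableOn.diffContOnCl ?_
    rw [closure_ball z hδ0.ne']
    exact hF.mono hsub
  have h := Complex.norm_deriv_le_of_forall_mem_sphere_norm_le hδ0 hd (C := C) fun w hw =>
    hC w (hsub (Metric.sphere_subset_closedBall hw))
  -- With `s = ‖z - 1/2‖`, `1/4 - s ^ 2 = (1/2 - s) (1/2 + s)` and the second factor is at most `1`.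
  have hle : hypWeight z ≤ δ := by
    rw [hypWeight]
    nlinarith [norm_nonneg (z - 1 / 2)]
  calc hypWeight z * ‖deriv F z‖ ≤ δ * (C / (δ / 2)) := by
        gcongr
    _ = 2 * C := by
        have : δ ≠ 0 := by linarith
        field_simp

lemma blochBound_norm (f : discAlgebra) : BlochBound f (2 * ‖f‖) := fun _ hz =>
  hypWeight_mul_norm_deriv_le_of_bound f.2 (fun w hw => by
    rw [zeroExtend_of_mem_discD _ hw]
    exact norm_apply_le f _) hz

/-- A contraction in a weak seminorm becomes one in norm once the operator is also bounded from the
seminorm to the norm. `B f C` plays the role of "the seminorm of `f` is at most `C`". -/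
lemma exists_norm_pow_lt_one {X : Type*} [NormedAddCommGroup X] [NormedSpace ℂ X]
    {P : X →L[ℂ] X} {B : X → ℝ → Prop} {κ K : ℝ} (hκ0 : 0 ≤ κ) (hκ1 : κ < 1)
    (hB : ∀ f, B f (2 * ‖f‖)) (hP : ∀ f C, B f C → B (P f) (κ * C))
    (hK : ∀ f C, B f C → ‖P f‖ ≤ K * C) : ∃ n : ℕ, ‖P ^ n‖ < 1 := by
  have hB' : ∀ (n : ℕ) (f : X), B ((P ^ n) f) (κ ^ n * (2 * ‖f‖)) := by
    intro n f
    induction n with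
    | zero => simpa using hB f
    | succ n ih =>
      rw [pow_succ', mul_apply_eq_comp, pow_succ', mul_assoc]
      exact hP _ _ ih
  have hlim : Tendsto (fun n : ℕ => |K| * (κ ^ n * 2)) atTop (𝓝 0) := by
    simpa using ((tendsto_pow_atTop_nhds_zero_of_lt_one hκ0 hκ1).mul_const 2).const_mul |K|
  obtain ⟨n, hn⟩ := (hlim.eventually_lt_const zero_lt_one).exists
  -- The extra application of `P` turns the seminorm bound on `P ^ n f` into a norm bound.
  refine ⟨n + 1, lt_of_le_of_lt (ContinuousLinearMap.opNorm_le_bound _ (by positivity)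
    fun f => ?_) hn⟩
  rw [pow_succ', mul_apply_eq_comp]
  calc ‖P ((P ^ n) f)‖ ≤ K * (κ ^ n * (2 * ‖f‖)) := hK _ _ (hB' n f)
    _ ≤ |K| * (κ ^ n * (2 * ‖f‖)) := by
        gcongr
        exact le_abs_self K
    _ = _ := by ring

variable {k : ℕ} {A : Fin k → Matrix (Fin 2) (Fin 2) ℝ}

lemma hasDerivAt_zeroExtend_comp (hM : ∀ r c, 0 < M r c) (f : discAlgebra) {z : ℂ}
    (hz : z ∈ discD) : HasDerivAt (fun z => zeroExtend f.1 (projAction M z))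
      (deriv (zeroExtend f.1) (projAction M z) * ((M.det : ℂ) / weightFn M z ^ 2)) z :=
  have hz' := discD_subset_closedBall hz
  HasDerivAt.comp z (hasDerivAt_zeroExtend f (proj_mem_discD hM hz'))
    (hasDerivAt_projAction (weight_ne_zero hM hz'))

/-- The center of the disc. -/
def discCenter : closedDisc := ⟨1 / 2, Metric.mem_closedBall_self (by norm_num)⟩

/-- The transfer operator at `t = 0`, modulo constants. -/
abbrev deflatedTransfer (hA : ∀ i r c, 0 < A i r c) (p : PMF (Fin k)) :
    discAlgebra →L[ℂ] discAlgebra :=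
  deflation (discTransfer hA p 0) (evalAt discCenter) 1

lemma deflatedTransfer_apply (hA : ∀ i r c, 0 < A i r c) (p : PMF (Fin k)) (f : discAlgebra)
    (z : closedDisc) : (deflatedTransfer hA p f).1 z =
      (discTransfer hA p 0 f).1 z - (discTransfer hA p 0 f).1 discCenter := by
  rw [← evalAt_apply, deflation_apply, map_sub, map_smul]
  change _ - _ * (1 : ℂ) = _
  rw [mul_one]
  rfl

/-- Deflation subtracts a constant, invisible to the derivative. The chain rule and Schwarz–Pick
give the factor `κ` for each branch, and the branches are averaged. -/
lemma BlochBound.deflatedTransfer (hA : ∀ i r c, 0 < A i r c) (p : PMF (Fin k)) {κ : ℝ}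
    (hκ0 : 0 ≤ κ)
    (hκ : ∀ i, |(A i).det| ≤ κ * (A i 0 0 * A i 1 1 + A i 0 1 * A i 1 0)) {f : discAlgebra} {C : ℝ}
    (h : BlochBound f C) : BlochBound (deflatedTransfer hA p f) (κ * C) := by
  intro z hz
  have hd : HasDerivAt (zeroExtend (_root_.deflatedTransfer hA p f).1)
      (∑ i, ((p i).toReal : ℂ) * (deriv (zeroExtend f.1) (projAction (A i) z) *
        (((A i).det : ℂ) / weightFn (A i) z ^ 2))) z := by
    have h1 := (HasDerivAt.fun_sum (u := Finset.univ) fun i _ =>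
      (hasDerivAt_zeroExtend_comp (hA i) f hz).const_mul ((p i).toReal : ℂ)).sub_const
        ((discTransfer hA p 0 f).1 discCenter)
    refine h1.congr_of_eventuallyEq ?_
    filter_upwards [isOpen_discD.mem_nhds hz] with w hw
    rw [zeroExtend_of_mem_discD _ hw, deflatedTransfer_apply, discTransfer_zero_apply]
    congr 1
    refine Finset.sum_congr rfl fun i _ => ?_
    rw [zeroExtend_of_mem_discD _ (proj_mem_discD (hA i) (discD_subset_closedBall hw))]
    rfl
  rw [hd.deriv]
  have hp := (hypWeight_pos hz).le
  calc hypWeight z * ‖∑ i, ((p i).toReal : ℂ) * (deriv (zeroExtend f.1) (projAction (A i) z) *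
          (((A i).det : ℂ) / weightFn (A i) z ^ 2))‖
      ≤ hypWeight z * ∑ i, (p i).toReal * (‖deriv (zeroExtend f.1) (projAction (A i) z)‖ *
          ‖((A i).det : ℂ) / weightFn (A i) z ^ 2‖) := by
        gcongr
        refine (norm_sum_le _ _).trans (le_of_eq (Finset.sum_congr rfl fun i _ => ?_))
        rw [norm_mul, norm_mul, Complex.norm_real, Real.norm_of_nonneg ENNReal.toReal_nonneg]
    _ = ∑ i, (p i).toReal * (‖deriv (zeroExtend f.1) (projAction (A i) z)‖ *
          (hypWeight z * ‖((A i).det : ℂ) / weightFn (A i) z ^ 2‖)) := by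
        rw [Finset.mul_sum]
        exact Finset.sum_congr rfl fun i _ => by ring
    _ ≤ ∑ i, (p i).toReal * (κ * C) := by
        refine Finset.sum_le_sum fun i _ => mul_le_mul_of_nonneg_left ?_ ENNReal.toReal_nonneg
        calc ‖deriv (zeroExtend f.1) (projAction (A i) z)‖ *
              (hypWeight z * ‖((A i).det : ℂ) / weightFn (A i) z ^ 2‖)
            ≤ ‖deriv (zeroExtend f.1) (projAction (A i) z)‖ *
              (κ * hypWeight (projAction (A i) z)) := by
              exact mul_le_mul_of_nonneg_left
                (hypWeight_mul_norm_deriv_le (hA i) (hκ i) hκ0 hz) (norm_nonneg _)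
          _ = κ * (hypWeight (projAction (A i) z) *
              ‖deriv (zeroExtend f.1) (projAction (A i) z)‖) := by ring
          _ ≤ κ * C := by
              gcongr
              exact h _ (proj_mem_discD (hA i) (discD_subset_closedBall hz))
    _ = κ * C := by rw [← Finset.sum_mul, sum_toReal_pmf, one_mul]

lemma exists_ball_projAction (hA : ∀ i r c, 0 < A i r c) :
    ∃ r < (1 / 2 : ℝ), ∀ i, ∀ z ∈ closedDisc, projAction (A i) z ∈ Metric.ball (1 / 2 : ℂ) r := by
  have hK : IsCompact (⋃ i, projAction (A i) '' closedDisc) :=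
    isCompact_iUnion fun i => (isCompact_closedBall _ _).image_of_continuousOn
      (differentiableOn_proj (hA i)).continuousOn
  have hs : (⋃ i, projAction (A i) '' closedDisc) ⊆ Metric.ball (1 / 2 : ℂ) (1 / 2) := by
    refine Set.iUnion_subset fun i => ?_
    rintro _ ⟨z, hz, rfl⟩
    exact proj_mem_discD (hA i) hz
  obtain ⟨r, hr, hsub⟩ := exists_lt_subset_ball hK.isClosed hs
  exact ⟨r, hr, fun i z hz => hsub (Set.mem_iUnion.2 ⟨i, z, hz, rfl⟩)⟩

/-- All images `φ_{A_i}(z)` lie in one smaller disc, where a Bloch bound is a genuine derivative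
bound; the mean value inequality then controls the oscillation. -/
lemma exists_norm_deflatedTransfer_le (hA : ∀ i r c, 0 < A i r c) (p : PMF (Fin k)) :
    ∃ K : ℝ, ∀ (f : discAlgebra) (C : ℝ), BlochBound f C → ‖deflatedTransfer hA p f‖ ≤ K * C := by
  obtain ⟨r, hr, hrA⟩ := exists_ball_projAction hA
  obtain ⟨i0, -⟩ := p.support_nonempty
  have hr0 : 0 < r := Metric.pos_of_mem_ball (hrA i0 _ discCenter.2)
  have hρ : 0 < 1 / 4 - r ^ 2 := by nlinarith
  refine ⟨(1 / 4 - r ^ 2)⁻¹, fun f C hC => ?_⟩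
  have hC0 := hC.nonneg
  have hosc : ∀ x ∈ Metric.ball (1 / 2 : ℂ) r, ∀ y ∈ Metric.ball (1 / 2 : ℂ) r,
      ‖zeroExtend f.1 y - zeroExtend f.1 x‖ ≤ (1 / 4 - r ^ 2)⁻¹ * C := by
    intro x hx y hy
    have hsub : Metric.ball (1 / 2 : ℂ) r ⊆ discD := Metric.ball_subset_ball hr.le
    have h1 := (convex_ball (1 / 2 : ℂ) r).norm_image_sub_le_of_norm_deriv_le
      (f := zeroExtend f.1) (C := (1 / 4 - r ^ 2)⁻¹ * C)
      (fun w hw => (hasDerivAt_zeroExtend f (hsub hw)).differentiableAt) (fun w hw => ?_) hx hy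
    · refine h1.trans (mul_le_of_le_one_right (by positivity) ?_)
      have := dist_triangle_right y x (1 / 2)
      rw [Metric.mem_ball] at hx hy
      rw [← dist_eq_norm]
      linarith
    · have h2 := hC w (hsub hw)
      have h3 : 1 / 4 - r ^ 2 ≤ hypWeight w := by
        rw [Metric.mem_ball, dist_eq_norm] at hw
        rw [hypWeight]
        nlinarith [norm_nonneg (w - 1 / 2)]
      rw [inv_mul_eq_div, le_div_iff₀' hρ]
      exact (mul_le_mul_of_nonneg_right h3 (norm_nonneg _)).trans h2
  refine norm_le_of_forall (by positivity) fun z => ?_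
  rw [deflatedTransfer_apply, discTransfer_zero_apply, discTransfer_zero_apply,
    ← Finset.sum_sub_distrib]
  calc _ ≤ ∑ i, (p i).toReal * ((1 / 4 - r ^ 2)⁻¹ * C) := by
        refine (norm_sum_le _ _).trans (Finset.sum_le_sum fun i _ => ?_)
        rw [← mul_sub, norm_mul, Complex.norm_real, Real.norm_of_nonneg ENNReal.toReal_nonneg]
        refine mul_le_mul_of_nonneg_left ?_ ENNReal.toReal_nonneg
        have := hosc _ (hrA i _ discCenter.2) _ (hrA i _ z.2)
        rw [← projMap_coe (hA i), ← projMap_coe (hA i)] at this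
        rwa [zeroExtend_apply _ (projMap (hA i) z).2,
          zeroExtend_apply _ (projMap (hA i) discCenter).2] at this
    _ = _ := by rw [← Finset.sum_mul, sum_toReal_pmf, one_mul]

lemma exists_contraction_rate [Nonempty (Fin k)] (hA : ∀ i r c, 0 < A i r c) :
    ∃ κ : ℝ, 0 ≤ κ ∧ κ < 1 ∧
      ∀ i, |(A i).det| ≤ κ * (A i 0 0 * A i 1 1 + A i 0 1 * A i 1 0) := by
  have hpos : ∀ i, 0 < A i 0 0 * A i 1 1 + A i 0 1 * A i 1 0 := fun i => by
    have := mul_pos (hA i 0 0) (hA i 1 1)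
    have := mul_pos (hA i 0 1) (hA i 1 0)
    linarith
  obtain ⟨i, hi⟩ := Finite.exists_max
    fun i => |(A i).det| / (A i 0 0 * A i 1 1 + A i 0 1 * A i 1 0)
  refine ⟨_, div_nonneg (abs_nonneg _) (hpos i).le, ?_, fun j => (div_le_iff₀ (hpos j)).1 (hi j)⟩
  -- `|ad - bc| < ad + bc` because both products are positive.
  rw [div_lt_one (hpos i), Matrix.det_fin_two, abs_lt]
  have := mul_pos (hA i 0 0) (hA i 1 1)
  have := mul_pos (hA i 0 1) (hA i 1 0)
  constructor <;> linarith

lemma exists_norm_deflatedTransfer_pow_lt_one (hA : ∀ i r c, 0 < A i r c) (p : PMF (Fin k)) :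
    ∃ n : ℕ, ‖deflatedTransfer hA p ^ n‖ < 1 := by
  obtain ⟨i0, -⟩ := p.support_nonempty
  have : Nonempty (Fin k) := ⟨i0⟩
  obtain ⟨κ, hκ0, hκ1, hκ⟩ := exists_contraction_rate hA
  obtain ⟨K, hK⟩ := exists_norm_deflatedTransfer_le hA p
  exact exists_norm_pow_lt_one hκ0 hκ1 blochBound_norm
    (fun f C h => h.deflatedTransfer hA p hκ0 hκ) hK

end Contraction

/-! ### Passing between the Hardy space and the disc algebra. -/

section Intertwining

/-- If `L = J T` and `S = T J`, then a nonzero dominant simple eigenvalue of `S` is the top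
eigenvalue of `L`. -/
lemma isTopEigenvalue_of_intertwining {V X : Type*} [AddCommGroup V] [Module ℂ V]
    [AddCommGroup X] [Module ℂ X] {L : Module.End ℂ V} {S : Module.End ℂ X} {T : V →ₗ[ℂ] X}
    {J : X →ₗ[ℂ] V} (hJT : ∀ f, J (T f) = L f) (hTJ : ∀ f, T (J f) = S f) {μ : ℂ} {h : X}
    (hne : J h ≠ 0) (hh : S h = μ • h) (hμ : μ ≠ 0)
    (hother : ∀ (ν : ℂ) (f : X), S f = ν • f → f ≠ 0 → ν ≠ μ → ‖ν‖ < ‖μ‖)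
    (hsimple : ∀ (c : ℂ) (f : X), S f = μ • f + c • h → ∃ a : ℂ, f = a • h) :
    IsTopEigenvalue L μ := by
  have hLe : L (J h) = μ • J h := by rw [← hJT, hTJ, hh, map_smul]
  have hT : ∀ f, S (T f) = T (L f) := fun f => by rw [← hTJ, hJT]
  have hev : L.HasEigenvalue μ :=
    Module.End.hasEigenvalue_of_hasEigenvector (Module.End.hasEigenvector_iff.2
      ⟨Module.End.mem_eigenspace_iff.2 hLe, hne⟩)
  have hstep : ∀ f, (L - μ • 1) f ∈ Submodule.span ℂ {J h} → f ∈ Submodule.span ℂ {J h} := by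
    intro f hf
    obtain ⟨c, hc⟩ := Submodule.mem_span_singleton.1 hf
    have hf' : L f = μ • f + c • J h := by
      rw [hc]
      simp
    -- `T (J h) = μ h` turns the coefficient `c` into `c μ`.
    obtain ⟨a, ha⟩ := hsimple (c * μ) (T f) (by
      rw [hT, hf', map_add, map_smul, map_smul, hTJ, hh, smul_smul])
    have hLf : L f = a • J h := by rw [← hJT, ha, map_smul]
    refine Submodule.mem_span_singleton.2 ⟨μ⁻¹ * (a - c), ?_⟩
    have : μ • f = (a - c) • J h := by
      rw [sub_smul, ← hLf, hf', add_sub_cancel_right]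
    rw [mul_smul, ← this, inv_smul_smul₀ hμ]
  have hgen : L.maxGenEigenspace μ = Submodule.span ℂ {J h} := by
    refine le_antisymm (fun f hf => ?_) ?_
    · obtain ⟨n, hn⟩ := (Module.End.mem_maxGenEigenspace _ _ _).1 hf
      clear hf
      induction n generalizing f with
      | zero =>
        have : f = 0 := by simpa using hn
        rw [this]
        exact zero_mem _
      | succ n ih =>
        exact hstep f (ih _ (by rwa [pow_succ] at hn))
    · rw [Submodule.span_singleton_le_iff_mem, Module.End.mem_maxGenEigenspace]
      exact ⟨1, by simp [hLe]⟩
  refine ⟨hev, by rw [hgen, finrank_span_singleton hne], fun ν hν hνμ => ?_⟩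
  obtain ⟨f, hf⟩ := hν.exists_hasEigenvector
  have hLf : L f = ν • f := hf.apply_eq_smul
  -- For `ν ≠ 0` the vector `T f` is nonzero because `J (T f) = ν f`, so it is an eigenvector of
  -- `S`.
  by_cases hν0 : ν = 0
  · simpa [hν0] using hμ
  · refine hother ν (T f) (by rw [hT, hLf, map_smul]) (fun h0 => hf.2 ?_) hνμ
    have h1 : L f = 0 := by rw [← hJT, h0, map_zero]
    rw [hLf] at h1
    exact (smul_eq_zero.1 h1).resolve_left hν0

variable {k : ℕ} {A : Fin k → Matrix (Fin 2) (Fin 2) ℝ}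

/-- The transfer operator maps the Hardy space to the disc algebra. -/
def hardyToDisc (hA : ∀ i r c, 0 < A i r c) (p : PMF (Fin k)) (t : ℂ) :
    hardySpace →ₗ[ℂ] discAlgebra where
  toFun f := toDiscAlgebra (transferFun A p t f) (transferFun_continuousOn hA p t f.2.1.1)
    (transferFun_differentiableOn hA p t f.2.1.1)
  map_add' f g := discAlgebra_ext fun z => by
    change transferFun A p t (f + g : ℂ → ℂ) z = transferFun A p t f z + transferFun A p t g z
    simp [transferFun, mul_add, Finset.sum_add_distrib]
  map_smul' c f := discAlgebra_ext fun z => by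
    change transferFun A p t (c • f : ℂ → ℂ) z = c * transferFun A p t f z
    simp [transferFun, Finset.mul_sum, mul_left_comm]

lemma memHardy_indicator_zeroExtend (f : discAlgebra) :
    discD.indicator (zeroExtend f.1) ∈ hardySpace := by
  have hd : DifferentiableOn ℂ (discD.indicator (zeroExtend f.1)) discD :=
    DifferentiableOn.congr f.2 fun z hz => Set.indicator_of_mem hz _
  refine ⟨⟨hd, ‖f‖ ^ 2, fun r h0 h1 => ?_⟩, fun z hz => Set.indicator_of_notMem hz _⟩
  refine Real.circleAverage_mono_on_of_le_circle (circleIntegrable_sq hd h0 h1) fun z hz => ?_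
  have hz' := sphere_subset_discD h0 h1 hz
  rw [Set.indicator_of_mem hz', zeroExtend_of_mem_discD _ hz']
  exact pow_le_pow_left₀ (norm_nonneg _) (norm_apply_le f _) 2

/-- The inclusion of the disc algebra into the Hardy space. -/
def discToHardy : discAlgebra →ₗ[ℂ] hardySpace where
  toFun f := ⟨discD.indicator (zeroExtend f.1), memHardy_indicator_zeroExtend f⟩
  map_add' f g := by
    ext z
    by_cases hz : z ∈ discD
    · simp [hz, zeroExtend_of_mem_discD]
    · simp [hz]
  map_smul' c f := by
    ext z
    by_cases hz : z ∈ discD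
    · simp [hz, zeroExtend_of_mem_discD]
    · simp [hz]

lemma discToHardy_apply (f : discAlgebra) {z : ℂ} (hz : z ∈ discD) :
    (discToHardy f : ℂ → ℂ) z = f.1 ⟨z, discD_subset_closedBall hz⟩ := by
  rw [← zeroExtend_of_mem_discD f.1 hz]
  exact Set.indicator_of_mem hz _

lemma discToHardy_hardyToDisc (hA : ∀ i r c, 0 < A i r c) (p : PMF (Fin k)) (t : ℂ)
    (f : hardySpace) : discToHardy (hardyToDisc hA p t f) = transferOperator A hA p t f := by
  ext z
  by_cases hz : z ∈ discD
  · rw [discToHardy_apply _ hz]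
    exact (Set.indicator_of_mem hz (transferFun A p t f)).symm
  · exact ((discToHardy (hardyToDisc hA p t f)).2.2 z hz).trans
      ((transferOperator A hA p t f).2.2 z hz).symm

/-- The transfer formula samples `f` only at points `φ_{A_i}(z)` of the open disc, so discarding
boundary values loses nothing. -/
lemma hardyToDisc_discToHardy (hA : ∀ i r c, 0 < A i r c) (p : PMF (Fin k)) (t : ℂ)
    (f : discAlgebra) : hardyToDisc hA p t (discToHardy f) = discTransfer hA p t f := by
  refine discAlgebra_ext fun z => ?_
  rw [discTransfer_apply]
  change transferFun A p t (discToHardy f : ℂ → ℂ) z = _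
  rw [transferFun]
  refine Finset.sum_congr rfl fun i _ => ?_
  rw [discToHardy_apply f (proj_mem_discD (hA i) z.2)]
  rfl

lemma isTopEigenvalue_of_discTransfer (hA : ∀ i r c, 0 < A i r c) (p : PMF (Fin k)) {t μ : ℂ}
    {h : discAlgebra} (hne : h.1 discCenter ≠ 0) (hh : discTransfer hA p t h = μ • h) (hμ : μ ≠ 0)
    (hother : ∀ (ν : ℂ) (f : discAlgebra), discTransfer hA p t f = ν • f → f ≠ 0 → ν ≠ μ →
      ‖ν‖ < ‖μ‖)
    (hsimple : ∀ (c : ℂ) (f : discAlgebra), discTransfer hA p t f = μ • f + c • h →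
      ∃ a : ℂ, f = a • h) :
    IsTopEigenvalue (transferOperator A hA p t) μ := by
  refine isTopEigenvalue_of_intertwining (S := (discTransfer hA p t).toLinearMap)
    (discToHardy_hardyToDisc hA p t) (hardyToDisc_discToHardy hA p t) (fun h0 => hne ?_) hh hμ
    hother hsimple
  have hz : (1 / 2 : ℂ) ∈ discD := Metric.mem_ball_self (by norm_num)
  exact (discToHardy_apply h hz).symm.trans (congrArg (fun f : hardySpace => (f : ℂ → ℂ) (1 / 2)) h0)

end Intertwining

/-! ### Matrix words and the telescoping of the weight cocycle. -/

section Words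

variable {k : ℕ} {A : Fin k → Matrix (Fin 2) (Fin 2) ℝ}

/-- The product of the matrices along a finite word. -/
def wordProd (A : Fin k → Matrix (Fin 2) (Fin 2) ℝ) {n : ℕ} (x : Fin n → Fin k) :
    Matrix (Fin 2) (Fin 2) ℝ :=
  (List.ofFn fun j => A (x j)).prod

lemma wordProd_zero (x : Fin 0 → Fin k) : wordProd A x = 1 := by simp [wordProd]

lemma wordProd_snoc {n : ℕ} (x : Fin n → Fin k) (i : Fin k) :
    wordProd A (Fin.snoc x i : Fin (n + 1) → Fin k) = wordProd A x * A i := by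
  rw [wordProd, List.ofFn_succ', List.concat_eq_append, List.prod_append]
  simp [wordProd]

/-- The alternative is needed for the empty word, whose product is the identity. -/
lemma wordProd_eq_one_or_pos (hA : ∀ i r c, 0 < A i r c) {n : ℕ} (x : Fin n → Fin k) :
    wordProd A x = 1 ∨ ∀ r c, 0 < wordProd A x r c := by
  induction n with
  | zero => exact Or.inl (wordProd_zero x)
  | succ n ih =>
    right
    rw [← Fin.snoc_init_self x, wordProd_snoc]
    rcases ih (Fin.init x) with h | h
    · simpa [h] using hA _
    · intro r c
      rw [Matrix.mul_apply]
      exact Finset.sum_pos (fun j _ => mul_pos (h r j) (hA _ j c)) Finset.univ_nonempty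

lemma weightFn_one (z : ℂ) : weightFn 1 z = 1 := by simp [weightFn]

lemma weightFn_wordProd_re_pos (hA : ∀ i r c, 0 < A i r c) {n : ℕ} (x : Fin n → Fin k) {z : ℂ}
    (hz : z ∈ closedDisc) : 0 < (weightFn (wordProd A x) z).re := by
  rcases wordProd_eq_one_or_pos hA x with h | h
  · rw [h, weightFn_one]
    exact one_pos
  · exact weight_re_pos h hz

/-- Cocycle identity: `w_M(z)` is the coordinate sum of `M (z, 1 - z)`, and `φ_M(z)` is the first
coordinate after normalising that sum to `1`. -/
lemma weightFn_mul (M N : Matrix (Fin 2) (Fin 2) ℝ) {z : ℂ} (hN : weightFn N z ≠ 0) :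
    weightFn (M * N) z = weightFn M (projAction N z) * weightFn N z := by
  rw [weightFn.eq_def M, projAction, add_mul, mul_assoc, div_mul_cancel₀ _ hN]
  simp only [weightFn, Matrix.mul_apply, Fin.sum_univ_two]
  push_cast
  ring

/-- Both arguments lie in `(-π/2, π/2)`, so their sum stays in the principal range. -/
lemma log_mul_of_re_pos {x y : ℂ} (hx : 0 < x.re) (hy : 0 < y.re) :
    Complex.log (x * y) = Complex.log x + Complex.log y := by
  have hx0 : x ≠ 0 := fun h => by simp [h] at hx
  have hy0 : y ≠ 0 := fun h => by simp [h] at hy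
  have h1 := abs_lt.1 (Complex.abs_arg_lt_pi_div_two_iff.2 (Or.inl hx))
  have h2 := abs_lt.1 (Complex.abs_arg_lt_pi_div_two_iff.2 (Or.inl hy))
  rw [Complex.log_mul_eq_add_log_iff hx0 hy0]
  constructor <;> linarith

/-- The probability of a finite word. -/
def wordWeight (p : PMF (Fin k)) {n : ℕ} (x : Fin n → Fin k) : ℝ := ∏ j, (p (x j)).toReal

lemma wordWeight_nonneg (p : PMF (Fin k)) {n : ℕ} (x : Fin n → Fin k) : 0 ≤ wordWeight p x :=
  Finset.prod_nonneg fun _ _ => ENNReal.toReal_nonneg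

lemma wordWeight_snoc (p : PMF (Fin k)) {n : ℕ} (x : Fin n → Fin k) (i : Fin k) :
    wordWeight p (Fin.snoc x i : Fin (n + 1) → Fin k) = wordWeight p x * (p i).toReal := by
  simp [wordWeight, Fin.prod_univ_castSucc]

lemma sum_snoc {E : Type*} [AddCommMonoid E] {n : ℕ} (F : (Fin (n + 1) → Fin k) → E) :
    ∑ x, F x = ∑ i, ∑ x : Fin n → Fin k, F (Fin.snoc x i) := by
  rw [← (Fin.snocEquiv fun _ : Fin (n + 1) => Fin k).sum_comp, Fintype.sum_prod_type]
  rfl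

lemma sum_wordWeight (p : PMF (Fin k)) (n : ℕ) : ∑ x : Fin n → Fin k, wordWeight p x = 1 := by
  induction n with
  | zero => simp [wordWeight]
  | succ n ih => simp [sum_snoc, wordWeight_snoc, ← Finset.sum_mul, ih, sum_toReal_pmf]

/-- The mean of the logarithm of the weight over the words of length `n`. -/
def wordMeanLog (A : Fin k → Matrix (Fin 2) (Fin 2) ℝ) (p : PMF (Fin k)) (n : ℕ) (z : ℂ) : ℂ :=
  ∑ x : Fin n → Fin k, (wordWeight p x : ℂ) * Complex.log (weightFn (wordProd A x) z)

/-- The last letter is the rightmost matrix, which acts on `z` first; splitting it off makes the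
recursion an application of the transfer operator at `t = 0`. -/
lemma wordMeanLog_succ (hA : ∀ i r c, 0 < A i r c) (p : PMF (Fin k)) (n : ℕ) {z : ℂ}
    (hz : z ∈ closedDisc) :
    wordMeanLog A p (n + 1) z = ∑ i, ((p i).toReal : ℂ) * wordMeanLog A p n (projAction (A i) z) +
      ∑ i, ((p i).toReal : ℂ) * Complex.log (weightFn (A i) z) := by
  rw [wordMeanLog, sum_snoc, ← Finset.sum_add_distrib]
  refine Finset.sum_congr rfl fun i _ => ?_
  have h1 : ∀ x : Fin n → Fin k, Complex.log (weightFn (wordProd A x * A i) z) =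
      Complex.log (weightFn (wordProd A x) (projAction (A i) z)) +
        Complex.log (weightFn (A i) z) := fun x => by
    rw [weightFn_mul _ _ (weight_ne_zero (hA i) hz)]
    exact log_mul_of_re_pos (weightFn_wordProd_re_pos hA x
      (discD_subset_closedBall (proj_mem_discD (hA i) hz))) (weight_re_pos (hA i) hz)
  have h2 : ∑ x : Fin n → Fin k, (wordWeight p x : ℂ) = 1 := by
    exact_mod_cast sum_wordWeight p n
  calc _ = ∑ x : Fin n → Fin k, (((p i).toReal : ℂ) * ((wordWeight p x : ℂ) *
          Complex.log (weightFn (wordProd A x) (projAction (A i) z))) +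
          (wordWeight p x : ℂ) * (((p i).toReal : ℂ) * Complex.log (weightFn (A i) z))) := by
        refine Finset.sum_congr rfl fun x _ => ?_
        rw [wordWeight_snoc, wordProd_snoc, h1]
        push_cast
        ring
    _ = _ := by rw [Finset.sum_add_distrib, ← Finset.sum_mul, h2, one_mul, wordMeanLog,
          Finset.mul_sum]

/-- If the mean logarithm of the weights is cohomologous to the constant `c`, then its Birkhoff
sums telescope. -/
lemma wordMeanLog_eq (hA : ∀ i r c, 0 < A i r c) (p : PMF (Fin k)) {c : ℂ} {v : discAlgebra}
    (hv : meanLogWeight hA p = c • 1 + v - discTransfer hA p 0 v) (n : ℕ) (z : closedDisc) :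
    wordMeanLog A p n z = n * c + v.1 z - ((discTransfer hA p 0)^[n] v).1 z := by
  induction n generalizing z with
  | zero => simp [wordMeanLog, wordProd_zero, weightFn_one]
  | succ n ih =>
    have hvz : (meanLogWeight hA p).1 z = c + v.1 z - (discTransfer hA p 0 v).1 z := by
      rw [hv]
      change c * 1 + v.1 z - _ = _
      rw [mul_one]
    have hs : ∑ i, ((p i).toReal : ℂ) = 1 := by exact_mod_cast sum_toReal_pmf p
    rw [wordMeanLog_succ hA p n z.2, ← meanLogWeight_apply hA p z, hvz,
      Function.iterate_succ_apply', discTransfer_zero_apply, discTransfer_zero_apply]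
    simp_rw [← projMap_coe (hA _), ih, mul_sub, mul_add, Finset.sum_sub_distrib,
      Finset.sum_add_distrib, ← Finset.sum_mul, hs]
    push_cast
    ring

lemma norm_discTransfer_zero_iterate_le (hA : ∀ i r c, 0 < A i r c) (p : PMF (Fin k))
    (v : discAlgebra) (n : ℕ) : ‖(discTransfer hA p 0)^[n] v‖ ≤ ‖v‖ := by
  induction n with
  | zero => rfl
  | succ n ih =>
    rw [Function.iterate_succ_apply']
    refine le_trans (norm_le_of_forall (norm_nonneg _) fun z => ?_) ih
    rw [discTransfer_zero_apply]
    calc _ ≤ ∑ i, (p i).toReal * ‖(discTransfer hA p 0)^[n] v‖ := by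
          refine (norm_sum_le _ _).trans (Finset.sum_le_sum fun i _ => ?_)
          rw [norm_mul, Complex.norm_real, Real.norm_of_nonneg ENNReal.toReal_nonneg]
          exact mul_le_mul_of_nonneg_left (norm_apply_le _ _) ENNReal.toReal_nonneg
      _ = _ := by rw [← Finset.sum_mul, sum_toReal_pmf, one_mul]

/-- `S_0` does not increase the sup norm, so the telescoped remainder is at most `2 ‖v‖` and
vanishes after division by `n`. -/
lemma tendsto_wordMeanLog_div (hA : ∀ i r c, 0 < A i r c) (p : PMF (Fin k)) {c : ℂ}
    {v : discAlgebra} (hv : meanLogWeight hA p = c • 1 + v - discTransfer hA p 0 v)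
    (z : closedDisc) :
    Tendsto (fun n : ℕ => (1 / (n : ℂ)) * wordMeanLog A p n z) atTop (𝓝 c) := by
  have hb : Tendsto (fun n : ℕ => (1 / (n : ℂ)) *
      (v.1 z - ((discTransfer hA p 0)^[n] v).1 z)) atTop (𝓝 0) := by
    refine tendsto_one_div_atTop_nhds_zero_nat.zero_mul_isBoundedUnder_le
      (isBoundedUnder_of ⟨2 * ‖v‖, fun n => ?_⟩)
    refine (norm_sub_le _ _).trans ?_
    have h1 := norm_apply_le v z
    have h2 := (norm_apply_le ((discTransfer hA p 0)^[n] v) z).trans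
      (norm_discTransfer_zero_iterate_le hA p v n)
    linarith
  have h := hb.const_add c
  rw [add_zero] at h
  refine h.congr' ?_
  filter_upwards [eventually_ne_atTop 0] with n hn
  have hn' : (n : ℂ) ≠ 0 := by exact_mod_cast hn
  rw [wordMeanLog_eq hA p hv]
  field_simp
  ring

end Words

/-! ### Operator norm versus the weight at the centre. -/

section MatrixNorm

variable {M : Matrix (Fin 2) (Fin 2) ℝ}

lemma half_sum_le_norm_toEuclideanCLM (M : Matrix (Fin 2) (Fin 2) ℝ) :
    (M 0 0 + M 0 1 + M 1 0 + M 1 1) / 2 ≤ ‖Matrix.toEuclideanCLM (𝕜 := ℝ) M‖ := by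
  -- Test vector `(1, 1)`: its quadratic form is the sum of the entries and its squared norm is `2`.
  set v : EuclideanSpace ℝ (Fin 2) := WithLp.toLp 2 fun _ => 1 with hv
  have hvn : ‖v‖ * ‖v‖ = 2 := by
    rw [← real_inner_self_eq_norm_mul_norm, PiLp.inner_apply]
    simp [hv]
  have h1 : inner ℝ v (Matrix.toEuclideanCLM (𝕜 := ℝ) M v) =
      M 0 0 + M 0 1 + M 1 0 + M 1 1 := by
    rw [Matrix.inner_toEuclideanCLM]
    simp [hv, dotProduct, Matrix.mulVec, Fin.sum_univ_two]
    ring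
  have h2 := real_inner_le_norm v (Matrix.toEuclideanCLM (𝕜 := ℝ) M v)
  have h3 := mul_le_mul_of_nonneg_left ((Matrix.toEuclideanCLM (𝕜 := ℝ) M).le_opNorm v)
    (norm_nonneg v)
  rw [h1] at h2
  rw [mul_left_comm, hvn] at h3
  linarith

lemma norm_toEuclideanCLM_le_sum (hM : ∀ r c, 0 ≤ M r c) :
    ‖Matrix.toEuclideanCLM (𝕜 := ℝ) M‖ ≤ M 0 0 + M 0 1 + M 1 0 + M 1 1 := by
  have ha := hM 0 0
  have hb := hM 0 1
  have hc := hM 1 0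
  have hd := hM 1 1
  refine ContinuousLinearMap.opNorm_le_bound _ (by positivity) fun v => ?_
  have hrow : ∀ i, |Matrix.toEuclideanCLM (𝕜 := ℝ) M v i| ≤ (M i 0 + M i 1) * ‖v‖ := fun i => by
    have e : Matrix.toEuclideanCLM (𝕜 := ℝ) M v i = M i 0 * v 0 + M i 1 * v 1 := by
      rw [Matrix.ofLp_toEuclideanCLM]
      simp [Matrix.mulVec, dotProduct, Fin.sum_univ_two]
    have h0 : |v 0| ≤ ‖v‖ := PiLp.norm_apply_le v 0
    have h1 : |v 1| ≤ ‖v‖ := PiLp.norm_apply_le v 1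
    rw [e]
    calc _ ≤ |M i 0 * v 0| + |M i 1 * v 1| := abs_add_le _ _
      _ = M i 0 * |v 0| + M i 1 * |v 1| := by
        rw [abs_mul, abs_mul, abs_of_nonneg (hM i 0), abs_of_nonneg (hM i 1)]
      _ ≤ M i 0 * ‖v‖ + M i 1 * ‖v‖ :=
        add_le_add (mul_le_mul_of_nonneg_left h0 (hM i 0)) (mul_le_mul_of_nonneg_left h1 (hM i 1))
      _ = _ := by ring
  rw [EuclideanSpace.norm_eq, Real.sqrt_le_left (by positivity), Fin.sum_univ_two,
    Real.norm_eq_abs, Real.norm_eq_abs]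
  have h0 := hrow 0
  have h1 := hrow 1
  have n0 := abs_nonneg (Matrix.toEuclideanCLM (𝕜 := ℝ) M v 0)
  have n1 := abs_nonneg (Matrix.toEuclideanCLM (𝕜 := ℝ) M v 1)
  calc _ ≤ (|Matrix.toEuclideanCLM (𝕜 := ℝ) M v 0| + |Matrix.toEuclideanCLM (𝕜 := ℝ) M v 1|) ^ 2 := by
        nlinarith
    _ ≤ _ := by
        gcongr
        linarith

lemma abs_log_norm_sub_log_le (hM : ∀ r c, 0 ≤ M r c)
    (hs : 0 < M 0 0 + M 0 1 + M 1 0 + M 1 1) :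
    |Real.log ‖Matrix.toEuclideanCLM (𝕜 := ℝ) M‖ -
      Real.log ((M 0 0 + M 0 1 + M 1 0 + M 1 1) / 2)| ≤ Real.log 2 := by
  have h1 := half_sum_le_norm_toEuclideanCLM M
  have h2 := norm_toEuclideanCLM_le_sum hM
  set s := M 0 0 + M 0 1 + M 1 0 + M 1 1
  have h3 : Real.log (s / 2) = Real.log s - Real.log 2 := Real.log_div hs.ne' two_ne_zero
  have h4 := Real.log_le_log (half_pos hs) h1
  have h5 := Real.log_le_log (lt_of_lt_of_le (half_pos hs) h1) h2
  have h6 : 0 < Real.log 2 := Real.log_pos one_lt_two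
  rw [abs_le]
  constructor <;> linarith

lemma weightFn_half (M : Matrix (Fin 2) (Fin 2) ℝ) :
    weightFn M (1 / 2) = (((M 0 0 + M 0 1 + M 1 0 + M 1 1) / 2 : ℝ) : ℂ) := by
  rw [weightFn]
  push_cast
  ring

end MatrixNorm

/-! ### Identification of the Lyapunov exponent. -/

section Lyapunov

variable {k : ℕ} {A : Fin k → Matrix (Fin 2) (Fin 2) ℝ}

lemma bernoulliMeasure_map_initial (p : PMF (Fin k)) (n : ℕ) :
    (bernoulliMeasure p).map (fun ω (j : Fin n) => ω j) = Measure.pi fun _ => p.toMeasure := by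
  symm
  refine Measure.pi_eq fun s _ => ?_
  rw [Measure.map_apply (by fun_prop) (MeasurableSet.univ_pi fun _ => .of_discrete)]
  have e : (fun ω (j : Fin n) => ω j) ⁻¹' Set.univ.pi s =
      Set.pi (Finset.range n) fun i => if h : i < n then s ⟨i, h⟩ else Set.univ := by
    ext ω
    simp only [Set.mem_preimage, Set.mem_pi, Set.mem_univ, true_imp_iff, Finset.coe_range,
      Set.mem_Iio]
    constructor
    · intro h i hi
      simpa [hi] using h ⟨i, hi⟩
    · intro h j
      simpa using h j j.2
  rw [e, bernoulliMeasure, Measure.infinitePi_pi _ fun _ _ => .of_discrete, Finset.prod_range]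
  simp

/-- The first `n` coordinates have the product law on a finite set, so the integral is a finite sum
over words. -/
lemma integral_bernoulliMeasure (p : PMF (Fin k)) {n : ℕ} (F : (Fin n → Fin k) → ℝ) :
    ∫ ω, F (fun j => ω j) ∂(bernoulliMeasure p) = ∑ x, wordWeight p x * F x := by
  have h := integral_map (μ := bernoulliMeasure p) (φ := fun ω (j : Fin n) => ω j) (f := F)
    (measurable_pi_lambda _ fun j => measurable_pi_apply _).aemeasurable
    (StronglyMeasurable.of_discrete.aestronglyMeasurable)
  rw [← h, bernoulliMeasure_map_initial, integral_fintype .of_finite]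
  refine Finset.sum_congr rfl fun x _ => ?_
  rw [smul_eq_mul, Measure.real, Measure.pi_singleton, ENNReal.toReal_prod, wordWeight]
  simp

lemma wordMeanLog_half (hA : ∀ i r c, 0 < A i r c) (p : PMF (Fin k)) (n : ℕ) :
    ∃ E : ℝ, wordMeanLog A p n (1 / 2) = E ∧
      |∑ x : Fin n → Fin k, wordWeight p x *
        Real.log ‖Matrix.toEuclideanCLM (𝕜 := ℝ) (wordProd A x)‖ - E| ≤ Real.log 2 := by
  have hpos : ∀ x : Fin n → Fin k, 0 < wordProd A x 0 0 + wordProd A x 0 1 + wordProd A x 1 0 +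
      wordProd A x 1 1 := fun x => by
    have := weightFn_wordProd_re_pos hA x discCenter.2
    rw [show (discCenter : ℂ) = 1 / 2 from rfl, weightFn_half, Complex.ofReal_re] at this
    linarith
  have hnonneg : ∀ (x : Fin n → Fin k) r c, 0 ≤ wordProd A x r c := fun x r c => by
    rcases wordProd_eq_one_or_pos hA x with h | h
    · rw [h, Matrix.one_apply]
      split_ifs <;> norm_num
    · exact (h r c).le
  refine ⟨∑ x : Fin n → Fin k, wordWeight p x * Real.log ((wordProd A x 0 0 + wordProd A x 0 1 +
    wordProd A x 1 0 + wordProd A x 1 1) / 2), ?_, ?_⟩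
  · rw [wordMeanLog]
    push_cast [weightFn_half]
    refine Finset.sum_congr rfl fun x _ => ?_
    have := Complex.ofReal_log (half_pos (hpos x)).le
    push_cast at this
    rw [this]
  · rw [← Finset.sum_sub_distrib]
    calc _ ≤ ∑ x : Fin n → Fin k, wordWeight p x * Real.log 2 := by
          refine (Finset.abs_sum_le_sum_abs _ _).trans (Finset.sum_le_sum fun x _ => ?_)
          rw [← mul_sub, abs_mul, abs_of_nonneg (wordWeight_nonneg p x)]
          exact mul_le_mul_of_nonneg_left (abs_log_norm_sub_log_le (hnonneg x) (hpos x))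
            (wordWeight_nonneg p x)
      _ = _ := by rw [← Finset.sum_mul, sum_wordWeight, one_mul]

lemma isLyapunovExponent_of_cohomologous (hA : ∀ i r c, 0 < A i r c) (p : PMF (Fin k)) {c : ℂ}
    {v : discAlgebra} (hv : meanLogWeight hA p = c • 1 + v - discTransfer hA p 0 v) :
    ∃ Λ : ℝ, c = Λ ∧ IsLyapunovExponent A p Λ := by
  choose E hE hEb using wordMeanLog_half hA p
  have hlim := tendsto_wordMeanLog_div hA p hv discCenter
  have hlim' : Tendsto (fun n : ℕ => (((1 / (n : ℝ)) * E n : ℝ) : ℂ)) atTop (𝓝 c) := by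
    refine hlim.congr fun n => ?_
    rw [show (discCenter : ℂ) = 1 / 2 from rfl, hE]
    push_cast
    rfl
  -- `c` is a limit of real numbers, since the weights at the centre are positive reals.
  have him : c.im = 0 := by
    have h := (Complex.continuous_im.tendsto c).comp hlim'
    simp only [Function.comp_def, Complex.ofReal_im] at h
    exact tendsto_nhds_unique h tendsto_const_nhds
  refine ⟨c.re, Complex.ext rfl (by simpa using him), ?_⟩
  have hre : Tendsto (fun n : ℕ => (1 / (n : ℝ)) * E n) atTop (𝓝 c.re) :=
    (Complex.continuous_re.tendsto c).comp hlim'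
  have herr : Tendsto (fun n : ℕ => (1 / (n : ℝ)) * (∑ x : Fin n → Fin k, wordWeight p x *
      Real.log ‖Matrix.toEuclideanCLM (𝕜 := ℝ) (wordProd A x)‖ - E n)) atTop (𝓝 0) :=
    tendsto_one_div_atTop_nhds_zero_nat.zero_mul_isBoundedUnder_le
      (isBoundedUnder_of ⟨Real.log 2, fun n => hEb n⟩)
  have h := herr.add hre
  rw [zero_add] at h
  refine h.congr fun n => ?_
  have hint := integral_bernoulliMeasure p
    fun x : Fin n → Fin k => Real.log ‖Matrix.toEuclideanCLM (𝕜 := ℝ) (wordProd A x)‖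
  simp only [wordProd] at hint ⊢
  rw [hint]
  ring

end Lyapunov

end

theorem proposition3p1 {k : ℕ} (A : Fin k → Matrix (Fin 2) (Fin 2) ℝ)
    (hA : ∀ i r c, 0 < A i r c) (hdet : ∀ i, (A i).det ≠ 0) (p : PMF (Fin k)) :
    ∃ (U : Set ℂ) (eig : ℂ → ℂ) (Λ : ℝ), IsOpen U ∧ (0 : ℂ) ∈ U ∧
      (∀ t ∈ U, IsTopEigenvalue (transferOperator A hA p t) (eig t)) ∧
      DifferentiableOn ℂ eig U ∧
      IsLyapunovExponent A p Λ ∧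
      HasDerivAt eig (Λ : ℂ) 0 := by
  obtain ⟨n, hn⟩ := exists_norm_deflatedTransfer_pow_lt_one hA p
  have hL := differentiable_discTransfer hA p
  have hu := discTransfer_zero_one hA p
  have hlu : evalAt discCenter 1 = 1 := rfl
  -- The normalising functional is evaluation at the centre of the disc, so `h t` has value `1`
  -- there and its image in the Hardy space is nonzero.
  obtain ⟨U, h, hU, h0U, hh, hh0, hspec⟩ := exists_dominant_eigenvalue hL hlu hu hn
  obtain ⟨heig, v, hv⟩ := exists_coboundary_of_eigenvalue hL hlu hu hU h0U hh hh0
    (fun t ht => (hspec t ht).2.1) (hasDerivAt_discTransfer_one hA p)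
  obtain ⟨Λ, hΛ, hlyap⟩ := isLyapunovExponent_of_cohomologous hA p hv
  refine ⟨U, fun t => evalAt discCenter (discTransfer hA p t (h t)), Λ, hU, h0U, fun t ht => ?_,
    heig, hlyap, ?_⟩
  · obtain ⟨h1, h2, h3, h4, h5⟩ := hspec t ht
    exact isTopEigenvalue_of_discTransfer hA p
      (by rw [← evalAt_apply, h1]; exact one_ne_zero) h2 h3 h4 h5
  · rw [← hΛ]
    exact (heig.differentiableAt (hU.mem_nhds h0U)).hasDerivAt
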